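/- **Setup.** Let $R$ be an irreducible reduced (crystallographic) root system with positive roots $R_+$, simple roots $\alpha_1,\dots,\alpha_n$, Weyl group $W$ with simple reflections $s_i$, and weight lattice $P$. Let $(\cdot,\cdot)$ be the invariant form with $(\alpha,\alpha)=2$ for the short roots $\alpha$; put $\nu_\alpha=(\alpha,\alpha)/2$, $\nu_R=\{\nu_\alpha\}$. Let $\alpha^\vee$ be the coroots, $\rho^\vee_\nu=\frac12\sum_{\alpha>0,\nu_\alpha=\nu}\alpha^\vee$, $\rho^\vee=\sum_\nu\rho^\vee_\nu$, and let $\vartheta$ be the maximal short root. Let $t_\nu^{1/2}$ ($\nu\in\nu_R$) be independent variables, $t_i=t_{\nu_{\alpha_i}}$ for $i>0$, $t_0=t_{\nu_\vartheta}$, and $q^{(\rho_k,b)}:=\prod_\nu t_\nu^{(\rho_\nu^\vee,b)}$ for $b\in P$. Put $\mathbb Q'_q=\mathbb Q(q^{1/(2m)})$, $\mathbb Q'_{q,t}=\mathbb Q'_q(t_\nu^{1/2})$, let $X_b$ ($b\in P$) be the monomials with $X_bX_c=X_{b+c}$, and let $W$ act on $\mathbb Q'_{q,t}(X)$ by $w(X_b)=X_{w(b)}$.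 In the algebra of operators $\sum_{v\in W}g_v v$ with $g_v\in\mathbb Q'_{q,t}(X)$, where $vg=v(g)v$, let $$T_i=t_i^{1/2}s_i+\frac{t_i^{1/2}-t_i^{-1/2}}{X_{\alpha_i}-1}(s_i-1)\quad(1\le i\le n),\qquad T_w=T_{i_1}\cdots T_{i_l}$$ for $w\in W$ and any reduced decomposition $w=s_{i_1}\cdots s_{i_l}$. Let $b_+$ be the dominant element of $W(b)$. Let $O'$ be the set of $r$ such that the fundamental weight $\omega_r$ satisfies $(\omega_r,\alpha^\vee)\le1$ for all $\alpha>0$; for $r\in O'$ put $u_r=w_0w_0^{r}$, with $w_0$ and $w_0^r$ the longest elements of $W$ and of the stabilizer of $\omega_r$, and $\lambda(u_r)=\{\alpha>0:\ u_r(\alpha)<0\}$. Define $$\check T_i=t_i^{1/2}T_i\ (i>0),\quad \check T_0=t_0^{1/2}T_{s_\vartheta}^{-1}X_\vartheta^{-1},\quad \tilde X_b=q^{(b_+,\rho_k)}X_b,\quad \check\pi_r^{-1}=X_{\omega_r}T_{u_r^{-1}}.$$ **Spinors and the limit.** Spinors are functions $f=\sum_{w\in W}f_w\zeta_w$ on $W$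 with values in rational functions of $X$; here $\zeta_w$ is the characteristic function of $w$. In the algebra of operators $\sum_{v,w\in W}g_{w,v}\zeta_w v$ on spinors, $v\in W$ acts only on the index: $v\,(g\zeta_w)=(g\zeta_{vw})\,v$. Let $\gamma$ be the automorphism $X_b\mapsto q^{-(\rho_k,b)}X_b$ of $\mathbb Q'_{q,t}(X)$ over $\mathbb Q'_{q,t}$. For an operator $L=\sum_vg_vv$ put $$\mathrm{\ae}^\delta(L)=\sum_{v\in W}\Big(\sum_{w\in W}\gamma\big(w^{-1}(g_v)\big)\zeta_w\Big)v .$$ The limit $RE^\delta(L)$ exists if all coefficients $\gamma(w^{-1}(g_v))$ are regular at $t_\nu^{1/2}=0$ (all $\nu$), i.e. are of the form $f/g$ where $f,g$ are Laurent polynomials in $X$ over $\mathbb Q'_q[t_\nu^{1/2},\nu\in\nu_R]$ and $g$ does not vanish identically at $t^{1/2}=0$; then $RE^\delta(L)$ is the operator whose coefficients are the values $f|_{t=0}/g|_{t=0}\in\mathbb Q'_q(X)$. **Proposition.** (i) The limits $\widehat T_i=RE^\delta(\check T_i)$ exist for all $0\le i\le n$, and for $i>0$ $$\widehat T_i=\sum_{w\in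 W:\ w^{-1}(\alpha_i)<0}\zeta_w\,(s_i-1).$$ (ii) For every $b\in P$ the limit $RE^\delta(\tilde X_b)$ exists and $$RE^\delta(\tilde X_b)=\sum_{w\in W:\ w^{-1}(b)=b_+}X_{b_+}\zeta_w .$$ (iii) For every $r\in O'$ the limit $RE^\delta(\check\pi_r^{-1})$ exists and $$RE^\delta(\check\pi_r^{-1})=\Bigg(\sum_{w\in W}X_{w^{-1}(\omega_r)}\prod_{\substack{\alpha\in\lambda(u_r)\\(w^{-1}(\alpha),\rho^\vee)=1}}\big(1-X^{-1}_{w^{-1}(\alpha)}\big)\,\zeta_w\Bigg)u_r^{-1}+\sum_{v<u_r^{-1}}\Big(\sum_{w\in W}f_{v,w}\zeta_w\Big)v$$ for certain Laurent polynomials $f_{v,w}\in\mathbb Q'_q[X_b,\ b\in P]$, where $<$ is the strict Bruhat order on $W$. -/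

import Mathlib

open scoped Classical

namespace SpinorRE

noncomputable section

/-! ### Root system data: Weyl group, root lengths, weights -/

section RootData

variable {ι M N : Type*} [AddCommGroup M] [Module ℝ M] [AddCommGroup N] [Module ℝ N]

/-- The Weyl group `W` acts faithfully on the finite set of roots, hence is finite. -/
instance finite_weylGroup [Finite ι] (P : RootPairing ι ℝ M N) [P.IsRootSystem] :
    Finite P.weylGroup := by
  refine Finite.of_injective (fun w : P.weylGroup => RootPairing.Equiv.indexHom P w.1) ?_
  intro w v h
  apply Subtype.ext
  apply RootPairing.Equiv.weightHom_injective P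
  apply LinearEquiv.toLinearMap_injective
  refine LinearMap.ext_on_range (RootPairing.IsRootSystem.span_root_eq_top (P := P)) fun i => ?_
  have hw := RootPairing.Hom.root_weightMap_apply P P i w.1.toHom
  have hv := RootPairing.Hom.root_weightMap_apply P P i v.1.toHom
  have hi : w.1.toHom.indexEquiv i = v.1.toHom.indexEquiv i :=
    congrArg (fun e : ι ≃ ι => e i) h
  calc _ = P.root (w.1.toHom.indexEquiv i) := hw
    _ = P.root (v.1.toHom.indexEquiv i) := by rw [hi]
    _ = _ := hv.symm

instance fintype_weylGroup [Finite ι] (P : RootPairing ι ℝ M N) [P.IsRootSystem] :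
    Fintype P.weylGroup := Fintype.ofFinite _

/-- `ν_α = (α, α) / 2` for the invariant form normalized by `(α, α) = 2` on the short roots:
the square of the length of `α` divided by the square of the length of the short roots. -/
def nu [Fintype ι] (P : RootPairing ι ℝ M N) (i : ι) : ℝ :=
  P.RootForm (P.root i) (P.root i) / ⨅ j, P.RootForm (P.root j) (P.root j)

/-- The set `ν_R = {ν_α}` of root lengths. -/
abbrev NuR [Fintype ι] (P : RootPairing ι ℝ M N) : Type := Set.range (nu P)

instance fintype_nuR [Fintype ι] (P : RootPairing ι ℝ M N) : Fintype (NuR P) := Fintype.ofFinite _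

/-- `ν_α` as an element of `ν_R`. -/
def nuOf [Fintype ι] (P : RootPairing ι ℝ M N) (i : ι) : NuR P := ⟨nu P i, i, rfl⟩

/-- The maximal short root `ϑ`: the short root that dominates all short roots, in the ordering
`x ≤ y ↔ y - x ∈ Q₊`. -/
def IsMaximalShortRoot [Fintype ι] {P : RootPairing ι ℝ M N} (b : P.Base) (θ : ι) : Prop :=
  nu P θ = 1 ∧ ∀ j, nu P j = 1 →
    P.root θ - P.root j ∈ AddSubmonoid.closure (P.root '' b.support)

/-- The weight lattice `P = {x : (x, α^∨) ∈ ℤ for all roots α}`. -/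
def weightLattice (P : RootPairing ι ℝ M N) : AddSubgroup M where
  carrier := {x | ∀ i, ∃ z : ℤ, P.toLinearMap x (P.coroot i) = z}
  zero_mem' i := ⟨0, by simp⟩
  add_mem' hx hy i := by
    obtain ⟨z, hz⟩ := hx i
    obtain ⟨z', hz'⟩ := hy i
    exact ⟨z + z', by simp [hz, hz']⟩
  neg_mem' hx i := by
    obtain ⟨z, hz⟩ := hx i
    exact ⟨-z, by simp [hz]⟩

/-- The integer `(x, α^∨)` for a weight `x` and a root `α`. -/
def wpair (P : RootPairing ι ℝ M N) (x : weightLattice P) (i : ι) : ℤ := (x.2 i).choose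

lemma wpair_spec (P : RootPairing ι ℝ M N) (x : weightLattice P) (i : ι) :
    ((wpair P x i : ℤ) : ℝ) = P.toLinearMap x.1 (P.coroot i) := (x.2 i).choose_spec.symm

lemma wpair_zero (P : RootPairing ι ℝ M N) (i : ι) : wpair P 0 i = 0 := by
  have := wpair_spec P 0 i
  simpa using this

lemma wpair_add (P : RootPairing ι ℝ M N) (x y : weightLattice P) (i : ι) :
    wpair P (x + y) i = wpair P x i + wpair P y i := by
  have h := wpair_spec P (x + y) i
  have hx := wpair_spec P x i
  have hy := wpair_spec P y i
  have : ((wpair P (x + y) i : ℤ) : ℝ) = ((wpair P x i + wpair P y i : ℤ) : ℝ) := by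
    rw [h]; push_cast; rw [hx, hy]; simp
  exact_mod_cast this

/-- Roots are weights, in the crystallographic case. -/
def rootWt (P : RootPairing ι ℝ M N) [P.IsCrystallographic] (i : ι) : weightLattice P :=
  ⟨P.root i, fun j => ⟨P.pairingIn ℤ i j, by
    rw [RootPairing.root_coroot_eq_pairing, ← P.algebraMap_pairingIn ℤ i j]
    rfl⟩⟩

lemma smul_mem_weightLattice (P : RootPairing ι ℝ M N) (w : P.weylGroup) {x : M}
    (hx : x ∈ weightLattice P) : w • x ∈ weightLattice P := by
  intro i
  obtain ⟨z, hz⟩ := hx (w.1.toHom.indexEquiv.symm i)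
  refine ⟨z, ?_⟩
  rw [← hz, ← RootPairing.Hom.coroot_coweightMap_apply]
  have h := RootPairing.Hom.weight_coweight_transpose_apply P P (P.coroot i) w.1.toHom
  exact LinearMap.congr_fun h x

/-- The action of `W` on the weight lattice. -/
instance actionWeight (P : RootPairing ι ℝ M N) :
    DistribMulAction P.weylGroup (weightLattice P) where
  smul w x := ⟨w • x.1, smul_mem_weightLattice P w x.2⟩
  one_smul x := Subtype.ext (one_smul _ x.1)
  mul_smul w v x := Subtype.ext (mul_smul w v x.1)
  smul_zero w := Subtype.ext (smul_zero w)
  smul_add w x y := Subtype.ext (smul_add w x.1 y.1)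

instance twoUniqueSums_weightLattice (P : RootPairing ι ℝ M N) :
    TwoUniqueSums (weightLattice P) := by
  let _ : Module ℚ M := Module.compHom M (algebraMap ℚ ℝ)
  exact TwoUniqueSums.of_injective_addHom ((weightLattice P).subtype : weightLattice P →ₙ+ M)
    Subtype.val_injective inferInstance

/-- `x` is the fundamental weight `ω_r`: `(ω_r, α_j^∨) = δ_{rj}` for the simple coroots. -/
def IsFundamentalWeight {P : RootPairing ι ℝ M N} (b : P.Base) (r : b.support)
    (x : weightLattice P) : Prop :=
  ∀ j : b.support, wpair P x j = if j = r then 1 else 0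

/-- `x ∈ P₊`. -/
def IsDominant {P : RootPairing ι ℝ M N} (b : P.Base) (x : weightLattice P) : Prop :=
  ∀ j : b.support, 0 ≤ wpair P x j

/-- The minuscule condition `(x, α^∨) ≤ 1` for all positive roots `α`. -/
def IsMinuscule {P : RootPairing ι ℝ M N} (b : P.Base) (x : weightLattice P) : Prop :=
  ∀ i, b.IsPos i → wpair P x i ≤ 1

/-- `ρ^∨`, half the sum of the positive coroots. -/
def rhoVee [Fintype ι] {P : RootPairing ι ℝ M N} (b : P.Base) : N :=
  (2⁻¹ : ℝ) • ∑ i with b.IsPos i, P.coroot i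

/-- The integer `2 (ρ_ν^∨, x) = ∑ (x, α^∨)`, over the positive roots with `ν_α = ν`. -/
def twoRhoPair [Fintype ι] {P : RootPairing ι ℝ M N} (b : P.Base) (ν : NuR P)
    (x : weightLattice P) : ℤ :=
  ∑ i with b.IsPos i ∧ nuOf P i = ν, wpair P x i

/-- The simple reflection `s_i` in `W`. -/
abbrev simpleRefl {P : RootPairing ι ℝ M N} (b : P.Base) (i : b.support) : P.weylGroup :=
  RootPairing.weylGroup.ofIdx P i

/-- The element `s_{i_1} ⋯ s_{i_l}` of `W` defined by a word in the simple reflections. -/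
def wordProd {P : RootPairing ι ℝ M N} (b : P.Base) (l : List b.support) : P.weylGroup :=
  (l.map (simpleRefl b)).prod

/-- The word `l` is a reduced decomposition of `w`. -/
def IsReducedWord {P : RootPairing ι ℝ M N} (b : P.Base) (l : List b.support)
    (w : P.weylGroup) : Prop :=
  wordProd b l = w ∧ ∀ l' : List b.support, wordProd b l' = w → l.length ≤ l'.length

/-- The length function of `W`. -/
def len {P : RootPairing ι ℝ M N} (b : P.Base) (w : P.weylGroup) : ℕ :=
  sInf {n | ∃ l : List b.support, wordProd b l = w ∧ l.length = n}

/-- The strict Bruhat order of `W`: `v < w` if `v ≠ w` is obtained by crossing out letters in a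
reduced decomposition of `w`. -/
def BruhatLT {P : RootPairing ι ℝ M N} (b : P.Base) (v w : P.weylGroup) : Prop :=
  v ≠ w ∧ ∃ l, IsReducedWord b l w ∧ ∃ l' : List b.support, l'.Sublist l ∧ wordProd b l' = v

/-- The longest element of a subgroup of `W` (an element of maximal length). -/
def longest [Finite ι] {P : RootPairing ι ℝ M N} [P.IsRootSystem] (b : P.Base)
    (H : Subgroup P.weylGroup) : P.weylGroup :=
  ((Finite.exists_max fun w : H => len b w.1).choose : H)

/-- `u_x = w₀ w₀^x` for `x ∈ P₊`: here `w₀` is the longest element of `W` and `w₀^x` that of the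
stabilizer of `x`. -/
def uElt [Finite ι] {P : RootPairing ι ℝ M N} [P.IsRootSystem] (b : P.Base)
    (x : weightLattice P) : P.weylGroup :=
  longest b ⊤ * longest b (MulAction.stabilizer P.weylGroup x)

/-- `λ(w) = {α > 0, w(α) < 0}` for `w ∈ W`. -/
def lambdaSet [Fintype ι] {P : RootPairing ι ℝ M N} (b : P.Base) (w : P.weylGroup) : Finset ι :=
  {i | b.IsPos i ∧ ¬ b.IsPos (w • i)}

end RootData

/-! ### Coefficients: Laurent polynomials and rational functions in the `X_b` -/

section Functions

variable {ι M N : Type*} [AddCommGroup M] [Module ℝ M] [AddCommGroup N] [Module ℝ N]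

/-- The field `ℚ(q^{1/(2m)})`, the variable of `RatFunc` being `q^{1/(2m)}`. -/
abbrev FieldQ : Type := RatFunc ℚ

/-- The polynomials in the variables `t_ν^{1/2}`, `ν ∈ ν_R`, over `ℚ(q^{1/(2m)})`. -/
abbrev PolyQT [Fintype ι] (P : RootPairing ι ℝ M N) : Type := MvPolynomial (NuR P) FieldQ

/-- The field `ℚ(q^{1/(2m)}, t_ν^{1/2})`. -/
def FieldQT [Fintype ι] (P : RootPairing ι ℝ M N) : Type := FractionRing (PolyQT P)

instance [Fintype ι] (P : RootPairing ι ℝ M N) : Field (FieldQT P) :=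
  inferInstanceAs (Field (FractionRing (PolyQT P)))

instance [Fintype ι] (P : RootPairing ι ℝ M N) : Algebra (PolyQT P) (FieldQT P) :=
  inferInstanceAs (Algebra (PolyQT P) (FractionRing (PolyQT P)))

instance [Fintype ι] (P : RootPairing ι ℝ M N) : IsFractionRing (PolyQT P) (FieldQT P) :=
  inferInstanceAs (IsFractionRing (PolyQT P) (FractionRing (PolyQT P)))

/-- The element `t_ν^{1/2}`. -/
def tHalf [Fintype ι] (P : RootPairing ι ℝ M N) (ν : NuR P) : FieldQT P :=
  algebraMap (PolyQT P) (FieldQT P) (MvPolynomial.X ν)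

/-- Laurent polynomials `k[X_b, b ∈ P]`, the group algebra of the weight lattice. -/
abbrev Laurent (k : Type*) [CommSemiring k] (P : RootPairing ι ℝ M N) : Type _ :=
  AddMonoidAlgebra k (weightLattice P)

instance isDomain_laurent (k : Type*) [CommRing k] [IsDomain k] (P : RootPairing ι ℝ M N) :
    IsDomain (Laurent k P) := NoZeroDivisors.to_isDomain _

/-- Rational functions `k(X)`, the field of fractions of `k[X_b, b ∈ P]`. -/
def RatX (k : Type*) [Field k] (P : RootPairing ι ℝ M N) : Type _ :=
  FractionRing (Laurent k P)

instance (k : Type*) [Field k] (P : RootPairing ι ℝ M N) : Field (RatX k P) :=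
  inferInstanceAs (Field (FractionRing (Laurent k P)))

instance (k : Type*) [Field k] (P : RootPairing ι ℝ M N) : Algebra (Laurent k P) (RatX k P) :=
  inferInstanceAs (Algebra (Laurent k P) (FractionRing (Laurent k P)))

instance (k : Type*) [Field k] (P : RootPairing ι ℝ M N) :
    IsFractionRing (Laurent k P) (RatX k P) :=
  inferInstanceAs (IsFractionRing (Laurent k P) (FractionRing (Laurent k P)))

/-- The monomial `X_b` as an element of `k(X)`. -/
def X (k : Type*) [Field k] {P : RootPairing ι ℝ M N} (x : weightLattice P) : RatX k P :=
  algebraMap (Laurent k P) (RatX k P) (AddMonoidAlgebra.single x 1)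

/-- The `k`-linear action of `W` on `k[X_b]`: `w(X_b) = X_{w(b)}`. -/
instance actionLaurent (k : Type*) [Field k] (P : RootPairing ι ℝ M N) :
    MulSemiringAction P.weylGroup (Laurent k P) where
  smul w f := AddMonoidAlgebra.domCongr k k (DistribMulAction.toAddEquiv (weightLattice P) w) f
  one_smul f := by
    change AddMonoidAlgebra.domCongr k k _ f = f
    ext x
    simp [AddMonoidAlgebra.coeff_domCongr, DistribMulAction.toAddEquiv]
  mul_smul w v f := by
    change AddMonoidAlgebra.domCongr k k _ f =
      AddMonoidAlgebra.domCongr k k _ (AddMonoidAlgebra.domCongr k k _ f)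
    ext x
    simp [AddMonoidAlgebra.coeff_domCongr, DistribMulAction.toAddEquiv, mul_smul]
  smul_zero w := map_zero _
  smul_add w := map_add _
  smul_one w := map_one _
  smul_mul w := map_mul _

/-- The induced action of `W` on `k(X)`. -/
instance actionRatX (k : Type*) [Field k] (P : RootPairing ι ℝ M N) :
    MulSemiringAction P.weylGroup (RatX k P) :=
  IsFractionRing.mulSemiringAction P.weylGroup (Laurent k P) (RatX k P)

variable [Fintype ι] {P : RootPairing ι ℝ M N}

/-- `q^{(ρ_k, x)} = ∏_ν t_ν^{(ρ_ν^∨, x)}`, where `t_ν = q_ν^{k_ν}`. -/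
def qRho (b : P.Base) (x : weightLattice P) : FieldQT P :=
  ∏ ν, tHalf P ν ^ twoRhoPair b ν x

lemma tHalf_ne_zero (ν : NuR P) : tHalf P ν ≠ 0 := by
  rw [tHalf, Ne, FaithfulSMul.algebraMap_eq_zero_iff]
  exact MvPolynomial.X_ne_zero ν

lemma qRho_ne_zero (b : P.Base) (x : weightLattice P) : qRho b x ≠ 0 :=
  Finset.prod_ne_zero_iff.mpr fun ν _ => zpow_ne_zero _ (tHalf_ne_zero ν)

lemma qRho_zero (b : P.Base) : qRho b 0 = 1 := by
  simp [qRho, twoRhoPair, wpair_zero]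

lemma qRho_add (b : P.Base) (x y : weightLattice P) : qRho b (x + y) = qRho b x * qRho b y := by
  simp only [qRho, ← Finset.prod_mul_distrib]
  refine Finset.prod_congr rfl fun ν _ => ?_
  rw [← zpow_add₀ (tHalf_ne_zero ν)]
  simp [twoRhoPair, wpair_add, Finset.sum_add_distrib]

/-- The `k`-algebra endomorphism `X_b ↦ q^{e (ρ_k, b)} X_b` of `k[X_b]`, for an integer `e`. -/
def shiftHom (b : P.Base) (e : ℤ) : Laurent (FieldQT P) P →ₐ[FieldQT P] Laurent (FieldQT P) P :=
  AddMonoidAlgebra.lift (FieldQT P) (Laurent (FieldQT P) P) (weightLattice P)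
    { toFun := fun x => AddMonoidAlgebra.single x.toAdd (qRho b x.toAdd ^ e)
      map_one' := by simp [qRho_zero, AddMonoidAlgebra.one_def]
      map_mul' := fun x y => by
        simp [qRho_add, mul_zpow, AddMonoidAlgebra.single_mul_single] }

lemma shiftHom_single (b : P.Base) (e : ℤ) (x : weightLattice P) (c : FieldQT P) :
    shiftHom b e (AddMonoidAlgebra.single x c) =
      AddMonoidAlgebra.single x (c * qRho b x ^ e) := by
  simp [shiftHom, AddMonoidAlgebra.lift_single]

lemma shiftHom_comp (b : P.Base) (e e' : ℤ) (h : e + e' = 0) :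
    (shiftHom b e).comp (shiftHom b e') = AlgHom.id _ _ := by
  refine AddMonoidAlgebra.algHom_ext (fun x => ?_) (Subsingleton.elim _ _)
  have : qRho b x ^ e' * qRho b x ^ e = 1 := by
    rw [← zpow_add₀ (qRho_ne_zero b x), add_comm, h, zpow_zero]
  simp [shiftHom_single, this]

/-- The translation `Γ_{-ρ_k}` on Laurent polynomials: `Γ_{-ρ_k}(X_b) = q^{-(ρ_k, b)} X_b`. -/
def gammaLaurent (b : P.Base) :
    Laurent (FieldQT P) P ≃ₐ[FieldQT P] Laurent (FieldQT P) P :=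
  AlgEquiv.ofAlgHom (shiftHom b (-1)) (shiftHom b 1)
    (shiftHom_comp b _ _ (by norm_num)) (shiftHom_comp b _ _ (by norm_num))

/-- The translation `Γ_{-ρ_k}` on rational functions. -/
def gamma (b : P.Base) : RatX (FieldQT P) P ≃+* RatX (FieldQT P) P :=
  IsFractionRing.ringEquivOfRingEquiv (gammaLaurent b).toRingEquiv

end Functions

/-! ### Spinors, difference-reflection operators without translations, and the limit -/

/-- The algebra of `W`-spinors with values in `F`: functions `W → F` with pointwise operations. -/
def Spin (W F : Type*) : Type _ := W → F

instance (W F : Type*) [CommRing F] : CommRing (Spin W F) := inferInstanceAs (CommRing (W → F))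

/-- The action `(δ(v) f)(u) = f(v⁻¹ u)` of `W` on spinors; it permutes the components only. -/
instance (W F : Type*) [Group W] [CommRing F] : MulSemiringAction W (Spin W F) where
  smul v f := fun u => f (v⁻¹ * u)
  one_smul f := funext fun u => by change f _ = f u; simp
  mul_smul v w f := funext fun u => by change f _ = f _; simp [mul_assoc]
  smul_zero _ := rfl
  smul_add _ _ _ := rfl
  smul_one _ := rfl
  smul_mul _ _ _ := rfl

/-- The spinor `f ζ_w`, whose `w`-component is `f` and whose other components vanish. -/
def zeta {W F : Type*} [CommRing F] (w : W) (f : F) : Spin W F := fun u => if u = w then f else 0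

/-- Spinor reflection operators `∑ g_{w,v} ζ_w δ(v)` with coefficients in `F`: the skew group
algebra in which `δ(v) f = (δ(v) f) δ(v)` for spinors `f`. -/
abbrev SpinOp (W F : Type*) [CommRing F] : Type _ := SkewMonoidAlgebra (Spin W F) W

/-- Multiplication by a spinor. -/
def spinMul {W F : Type*} [Group W] [CommRing F] (f : Spin W F) : SpinOp W F :=
  SkewMonoidAlgebra.single 1 f

/-- The operator `δ(v)` on spinors. -/
def delta {W : Type*} (F : Type*) [CommRing F] (v : W) : SpinOp W F :=
  SkewMonoidAlgebra.single v 1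

section Operators

variable {ι M N : Type*} [AddCommGroup M] [Module ℝ M] [AddCommGroup N] [Module ℝ N] [Fintype ι]
  {P : RootPairing ι ℝ M N}

/-- Difference-reflection operators `∑ g_v v`, `g_v ∈ ℚ(q^{1/(2m)}, t_ν^{1/2})(X)`, `v ∈ W` (those
without translations): the skew group algebra in which `v g = v(g) v` for functions `g`. -/
abbrev ReflOp (P : RootPairing ι ℝ M N) : Type _ :=
  SkewMonoidAlgebra (RatX (FieldQT P) P) P.weylGroup

/-- Multiplication by a function. -/
def fn (g : RatX (FieldQT P) P) : ReflOp P := SkewMonoidAlgebra.single 1 g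

/-- The element `v ∈ W` as an operator. -/
def refl (v : P.weylGroup) : ReflOp P := SkewMonoidAlgebra.single v 1

/-- `t_ν^{1/2}` as a constant function. -/
def tHalfFn (P : RootPairing ι ℝ M N) (ν : NuR P) : RatX (FieldQT P) P :=
  algebraMap (Laurent (FieldQT P) P) (RatX (FieldQT P) P)
    (algebraMap (FieldQT P) (Laurent (FieldQT P) P) (tHalf P ν))

/-- `q^{(ρ_k, x)}` as a constant function. -/
def qRhoFn (b : P.Base) (x : weightLattice P) : RatX (FieldQT P) P :=
  algebraMap (Laurent (FieldQT P) P) (RatX (FieldQT P) P)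
    (algebraMap (FieldQT P) (Laurent (FieldQT P) P) (qRho b x))

/-- The Demazure-Lusztig operator
`T_i = t_i^{1/2} s_i + (t_i^{1/2} - t_i^{-1/2}) (X_{α_i} - 1)⁻¹ (s_i - 1)`, `i > 0`. -/
def T [P.IsCrystallographic] (b : P.Base) (i : b.support) : ReflOp P :=
  fn (tHalfFn P (nuOf P i)) * refl (simpleRefl b i) +
    fn ((tHalfFn P (nuOf P i) - (tHalfFn P (nuOf P i))⁻¹) *
        (X (FieldQT P) (rootWt P (i : ι)) - 1)⁻¹) *
      (refl (simpleRefl b i) - 1)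

/-- `T_{i_1} ⋯ T_{i_l}`; this is `T_w` if the word is a reduced decomposition of `w ∈ W`. -/
def Tword [P.IsCrystallographic] (b : P.Base) (l : List b.support) : ReflOp P :=
  (l.map (T b)).prod

/-- The homomorphism `∑ g_v v ↦ ∑ ϱ(g_v) δ(v)` to spinor operators, where
`ϱ(g) = ∑_w w⁻¹(g) ζ_w`. -/
def toSpin (L : ReflOp P) : SpinOp P.weylGroup (RatX (FieldQT P) P) :=
  ⟨L.coeff.mapRange (fun g w => w⁻¹ • g) (funext fun w => smul_zero (w⁻¹))⟩

lemma gamma_zero (b : P.Base) : gamma b 0 = 0 := RingEquiv.map_zero _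

/-- The translation `Γ_{-ρ_k}` applied to all components of a spinor. -/
def gammaSpin (b : P.Base) (f : Spin P.weylGroup (RatX (FieldQT P) P)) :
    Spin P.weylGroup (RatX (FieldQT P) P) := fun w => gamma b (f w)

lemma gammaSpin_zero (b : P.Base) : gammaSpin b 0 = 0 := funext fun _ => gamma_zero b

/-- Conjugation by `δ(X_{ρ_k} Γ_{-ρ_k})`. On operators without translations the factor
`δ(X_{ρ_k})` acts trivially, and `δ(Γ_{-ρ_k})` commutes with the `ζ_w` and `δ(v)`; so the
conjugation amounts to applying `Γ_{-ρ_k}` to all components of the coefficients. -/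
def conjGamma (b : P.Base) (A : SpinOp P.weylGroup (RatX (FieldQT P) P)) :
    SpinOp P.weylGroup (RatX (FieldQT P) P) :=
  ⟨A.coeff.mapRange (gammaSpin b) (gammaSpin_zero b)⟩

/-- `æ^δ(L)`. -/
def aeDelta (b : P.Base) (L : ReflOp P) : SpinOp P.weylGroup (RatX (FieldQT P) P) :=
  conjGamma b (toSpin L)

/-- The substitution `t_ν^{1/2} = 0` for all `ν` in a Laurent polynomial in the `X_b` with
coefficients polynomial in the `t_ν^{1/2}`. -/
def atZero (P : RootPairing ι ℝ M N) : Laurent (PolyQT P) P →+* Laurent FieldQ P :=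
  AddMonoidAlgebra.mapRingHom (weightLattice P) (MvPolynomial.constantCoeff)

/-- The inclusion of such Laurent polynomials in the field of rational functions. -/
def incl (P : RootPairing ι ℝ M N) : Laurent (PolyQT P) P →+* RatX (FieldQT P) P :=
  (algebraMap (Laurent (FieldQT P) P) (RatX (FieldQT P) P)).comp
    (AddMonoidAlgebra.mapRingHom (weightLattice P) (algebraMap (PolyQT P) (FieldQT P)))

/-- The rational function `c` is regular at `t_ν^{1/2} = 0` (all `ν`), with value `c₀`: it can be
written as `f / g` where `g` does not vanish at `t = 0`, and `c₀ = f(0) / g(0)`. -/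
def HasValueAtZero (c : RatX (FieldQT P) P) (c₀ : RatX FieldQ P) : Prop :=
  ∃ f g : Laurent (PolyQT P) P, atZero P g ≠ 0 ∧ c * incl P g = incl P f ∧
    c₀ * algebraMap _ (RatX FieldQ P) (atZero P g) = algebraMap _ (RatX FieldQ P) (atZero P f)

/-- `RE^δ(L)` exists and equals `L₀`: all coefficients of `æ^δ(L)` are regular at `t_ν = 0`, and
`L₀` has their values as its coefficients. -/
def HasRE (b : P.Base) (L : ReflOp P) (L₀ : SpinOp P.weylGroup (RatX FieldQ P)) : Prop :=
  ∀ v w, HasValueAtZero ((aeDelta b L).coeff v w) (L₀.coeff v w)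

end Operators

end

end SpinorRE

namespace SpinorRE
noncomputable section

/-! ### The Weyl group action on roots, weights and pairings; positivity through heights. -/

section RootCombinatorics

variable {ι M N : Type*} [AddCommGroup M] [Module ℝ M] [AddCommGroup N] [Module ℝ N]

open RootPairing

/-! Put u = w⁻¹. The w-component of æ^δ of a function g is γ(u(g)), and X_b becomes q^{-(ρ_k, u(b))}
X_{u(b)}. All claims therefore concern orders in the t_ν^{1/2}, which are recorded as integer
vectors indexed by ν_R. Values at t = 0 are computed with denominators that specialize to 1
(`HasLaurentValue`): this class is closed under sums, products and inverses of functions of value 1,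
and its values are Laurent polynomials, as (iii) demands.

The coefficients of T_i. Let α = u(α_i) > 0 and y = q^{(ρ_k, α)} X_α⁻¹. The coefficient of s_i
becomes t_i^{1/2} (1 - t_i⁻¹ y) / (1 - y). Since 2(ρ_ν^∨, α) is at least 2 for ν = ν_α and at least
0 otherwise, with equality for all ν exactly when (α, ρ^∨) = 1, the last fraction tends to 1 - X_α⁻¹
or to 1 (`evalAt_moveCoeff`). For α < 0 the coefficient is t_i^{-1/2} times a function tending to 1.
The coefficient of the identity has order at least -1/2 in t_i, and gains the extra factor y when α
> 0. This already gives the limits of t_i^{1/2} T_i.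

For (ii), the exponents 2(ρ_ν^∨, b_+ - u(b)) are non-negative, and all vanish only if u(b) = b_+
(`smul_eq_self_of_twoRhoVec_eq`).

For (iii), let inv(w) count the inversions of w by root length. Induction along a reduced word shows
that the coefficients of T_w at u have order at least inv(uw) - inv(u) (`opOrder_Tword`). A letter
acting by its reflection changes this quantity exactly as its coefficient requires. A letter acting
by the identity needs two estimates for a positive root α: inv(w s_α) - inv(w) is at least the unit
vector of ν_α if w(α) > 0, and at least this vector minus 2(ρ_ν^∨, α) in any case. If ω is
minuscule, then inv(u u_r⁻¹) - inv(u) = 2(ρ_ν^∨, u(ω)), which exactly cancels the factor produced by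
X_ω. The coefficient of w itself in T_w arises only when every letter acts by its reflection, hence
the product over λ(u_r).

For T_0, the inverses T_j⁻¹ are applied one at a time to X_ϑ⁻¹. One bound holds until the letter
whose associated root is ϑ is reached, another one after it
(`IsMaximalShortRoot.opOrder_prod_Tinv`). At the end the order is at least that of t_0^{-1/2},
compensated by the prefactor. -/

lemma ofIdx_smul_index (P : RootPairing ι ℝ M N) (i j : ι) :
    weylGroup.ofIdx P i • j = P.reflectionPerm i j := rfl

lemma root_smul (P : RootPairing ι ℝ M N) (w : P.weylGroup) (i : ι) :
    P.root (w • i) = w • P.root i :=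
  RootPairing.Equiv.root_indexEquiv_eq_smul (P := P) i w.1

lemma ofIdx_smul_apply (P : RootPairing ι ℝ M N) (i : ι) (x : M) :
    weylGroup.ofIdx P i • x = x - P.toLinearMap x (P.coroot i) • P.root i := by
  change P.reflection i x = _
  rw [P.reflection_apply]; rfl

lemma weyl_smul_real (P : RootPairing ι ℝ M N) (w : P.weylGroup) (t : ℝ) (x : M) :
    w • (t • x) = t • w • x := smul_comm w.1 t x

/-- An element of the Weyl group is determined by its action on the ambient space. -/
lemma weyl_ext (P : RootPairing ι ℝ M N) {w v : P.weylGroup} (h : ∀ x : M, w • x = v • x) :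
    w = v := by
  apply Subtype.ext
  apply RootPairing.Equiv.weightHom_injective P
  exact LinearEquiv.ext h

lemma toLinearMap_smul_smul (P : RootPairing ι ℝ M N) (w : P.weylGroup) (x : M) (i : ι) :
    P.toLinearMap (w • x) (P.coroot (w • i)) = P.toLinearMap x (P.coroot i) := by
  have h := LinearMap.congr_fun
    (RootPairing.Hom.weight_coweight_transpose_apply P P (P.coroot (w • i)) w.1.toHom) x
  have h2 := RootPairing.Hom.coroot_coweightMap_apply P P (w • i) w.1.toHom
  have h3 : w.1.toHom.indexEquiv.symm (w • i) = i := w.1.toHom.indexEquiv.symm_apply_apply i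
  rw [h3] at h2
  rw [h2] at h
  exact h

lemma wpair_smul (P : RootPairing ι ℝ M N) (w : P.weylGroup) (x : weightLattice P) (i : ι) :
    wpair P (w • x) (w • i) = wpair P x i := by
  have h1 := wpair_spec P (w • x) (w • i)
  have h2 := wpair_spec P x i
  have h3 := toLinearMap_smul_smul P w x.1 i
  have : ((wpair P (w • x) (w • i) : ℤ) : ℝ) = (wpair P x i : ℤ) := by
    rw [h1, h2]; exact h3
  exact_mod_cast this

lemma wpair_smul_left (P : RootPairing ι ℝ M N) (w : P.weylGroup) (x : weightLattice P) (i : ι) :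
    wpair P (w • x) i = wpair P x (w⁻¹ • i) := by
  rw [← wpair_smul P w x (w⁻¹ • i), smul_inv_smul]

lemma wpair_neg (P : RootPairing ι ℝ M N) (x : weightLattice P) (i : ι) :
    wpair P (-x) i = - wpair P x i := by
  have := wpair_add P x (-x) i
  rw [add_neg_cancel, wpair_zero] at this
  linarith

lemma ofIdx_mul_self (P : RootPairing ι ℝ M N) (i : ι) :
    weylGroup.ofIdx P i * weylGroup.ofIdx P i = 1 := by
  apply weyl_ext
  intro x
  rw [mul_smul, one_smul]
  exact P.reflection_same i x

lemma ofIdx_inv (P : RootPairing ι ℝ M N) (i : ι) :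
    (weylGroup.ofIdx P i)⁻¹ = weylGroup.ofIdx P i :=
  inv_eq_of_mul_eq_one_left (ofIdx_mul_self P i)

lemma conj_ofIdx (P : RootPairing ι ℝ M N) (w : P.weylGroup) (i : ι) :
    w * weylGroup.ofIdx P i * w⁻¹ = weylGroup.ofIdx P (w • i) := by
  apply weyl_ext
  intro x
  rw [mul_smul, mul_smul, ofIdx_smul_apply, ofIdx_smul_apply, smul_sub, smul_inv_smul,
    weyl_smul_real, root_smul]
  congr 2
  have := toLinearMap_smul_smul P w (w⁻¹ • x) i
  rw [smul_inv_smul] at this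
  rw [this]

lemma mul_ofIdx (P : RootPairing ι ℝ M N) (w : P.weylGroup) (i : ι) :
    w * weylGroup.ofIdx P i = weylGroup.ofIdx P (w • i) * w := by
  rw [← conj_ofIdx]; group

/-- The index of the negative root. -/
def negIdx (P : RootPairing ι ℝ M N) (i : ι) : ι := P.reflectionPerm i i

lemma root_negIdx (P : RootPairing ι ℝ M N) (i : ι) : P.root (negIdx P i) = - P.root i := by
  simp [negIdx, root_reflectionPerm]

lemma coroot_negIdx (P : RootPairing ι ℝ M N) (i : ι) : P.coroot (negIdx P i) = - P.coroot i := by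
  simp [negIdx, coroot_reflectionPerm]

lemma negIdx_negIdx (P : RootPairing ι ℝ M N) (i : ι) : negIdx P (negIdx P i) = i := by
  apply P.root.injective; simp [root_negIdx]

lemma smul_negIdx (P : RootPairing ι ℝ M N) (w : P.weylGroup) (i : ι) :
    w • negIdx P i = negIdx P (w • i) := by
  apply P.root.injective; simp [root_negIdx, root_smul]

lemma ofIdx_smul_self (P : RootPairing ι ℝ M N) (i : ι) :
    weylGroup.ofIdx P i • i = negIdx P i := rfl

lemma ofIdx_negIdx (P : RootPairing ι ℝ M N) (i : ι) :
    weylGroup.ofIdx P (negIdx P i) = weylGroup.ofIdx P i := by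
  apply weyl_ext
  intro x
  rw [ofIdx_smul_apply, ofIdx_smul_apply, root_negIdx, coroot_negIdx]
  simp

lemma wpair_negIdx (P : RootPairing ι ℝ M N) (x : weightLattice P) (i : ι) :
    wpair P x (negIdx P i) = - wpair P x i := by
  have h1 := wpair_spec P x i
  have h2 := wpair_spec P x (negIdx P i)
  rw [coroot_negIdx, map_neg, ← h1] at h2
  exact_mod_cast h2

lemma negIdx_ne (P : RootPairing ι ℝ M N) (i : ι) : negIdx P i ≠ i := by
  intro h
  have h2 := root_negIdx P i
  rw [h] at h2
  have h3 : (2 : ℝ) • P.root i = 0 := by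
    rw [two_smul]; nth_rewrite 2 [h2]; exact add_neg_cancel _
  exact P.ne_zero i ((smul_eq_zero.mp h3).resolve_left two_ne_zero)

lemma isPos_negIdx {P : RootPairing ι ℝ M N} (b : P.Base) (i : ι) :
    b.IsPos (negIdx P i) ↔ ¬ b.IsPos i := Base.IsPos.neg_iff_not b i

section Crystallographic

variable (P : RootPairing ι ℝ M N) [P.IsCrystallographic]

lemma wpair_rootWt (i j : ι) : ((wpair P (rootWt P i) j : ℤ) : ℝ) = P.pairing i j := by
  rw [wpair_spec]; rfl

lemma wpair_rootWt_eq (i j : ι) : wpair P (rootWt P i) j = P.pairingIn ℤ i j := by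
  have h := wpair_rootWt P i j
  have h2 := P.algebraMap_pairingIn ℤ i j
  rw [← h2] at h
  exact Int.cast_injective h

lemma wpair_rootWt_self (i : ι) : wpair P (rootWt P i) i = 2 := by
  have := wpair_rootWt P i i
  rw [P.pairing_same] at this
  exact_mod_cast this

lemma smul_rootWt (w : P.weylGroup) (i : ι) : w • rootWt P i = rootWt P (w • i) :=
  Subtype.ext (root_smul P w i).symm

lemma rootWt_negIdx (i : ι) : rootWt P (negIdx P i) = - rootWt P i :=
  Subtype.ext (root_negIdx P i)

lemma ofIdx_smul_weight (i : ι) (x : weightLattice P) :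
    weylGroup.ofIdx P i • x = x - wpair P x i • rootWt P i := by
  apply Subtype.ext
  change weylGroup.ofIdx P i • x.1 = x.1 - wpair P x i • P.root i
  rw [ofIdx_smul_apply, ← wpair_spec, Int.cast_smul_eq_zsmul]

end Crystallographic

/-- The height extends to a linear functional. -/
lemma exists_height_functional {P : RootPairing ι ℝ M N} [P.IsRootSystem] (b : P.Base) :
    ∃ h : M →ₗ[ℝ] ℝ, ∀ i, h (P.root i) = b.height i := by
  refine ⟨∑ j : b.support, b.toWeightBasis.coord j, fun i => ?_⟩
  obtain ⟨f, hf, -, hi⟩ := b.exists_root_eq_sum_int i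
  rw [Base.height_eq_sum hi, hi, map_sum, Int.cast_sum]
  refine Finset.sum_congr rfl fun j hj => ?_
  rw [map_zsmul, LinearMap.sum_apply, zsmul_eq_mul]
  have : ∑ k : b.support, b.toWeightBasis.coord k (P.root j) = 1 := by
    have h1 : b.toWeightBasis.repr (P.root j) = Finsupp.single ⟨j, hj⟩ 1 :=
      b.toWeightBasis_repr_root ⟨j, hj⟩
    simp [Module.Basis.coord_apply, h1, Finsupp.single_apply]
  rw [this, mul_one]

lemma height_nonneg_of_mem_closure {P : RootPairing ι ℝ M N} {b : P.Base} {h : M →ₗ[ℝ] ℝ}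
    (hh : ∀ i, h (P.root i) = b.height i) {x : M}
    (hx : x ∈ AddSubmonoid.closure (P.root '' b.support)) : 0 ≤ h x := by
  induction hx using AddSubmonoid.closure_induction with
  | mem x hx =>
    obtain ⟨j, hj, rfl⟩ := hx
    rw [hh, Base.height_one_of_mem_support hj]; norm_num
  | zero => simp
  | add x y _ _ hx hy => rw [map_add]; linarith

lemma root_mem_closure_of_isPos {P : RootPairing ι ℝ M N} [P.IsRootSystem] (b : P.Base) {i : ι}
    (hi : b.IsPos i) : P.root i ∈ AddSubmonoid.closure (P.root '' b.support) := by
  obtain ⟨h, hh⟩ := exists_height_functional b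
  refine (b.root_mem_or_neg_mem i).resolve_right fun hn => ?_
  have h1 := height_nonneg_of_mem_closure hh hn
  rw [map_neg, hh] at h1
  have h2 : (0 : ℝ) < b.height i := by exact_mod_cast hi
  linarith

variable [Fintype ι]

lemma rootForm_smul_smul (P : RootPairing ι ℝ M N) (w : P.weylGroup) (x y : M) :
    P.RootForm (w • x) (w • y) = P.RootForm x y := by
  exact RootPairing.InvariantForm.apply_weylGroup_smul (P := P) (B := P.toInvariantForm) w x y

lemma nuOf_smul (P : RootPairing ι ℝ M N) (w : P.weylGroup) (i : ι) :
    nuOf P (w • i) = nuOf P i := by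
  apply Subtype.ext
  simp only [nuOf, nu]
  rw [root_smul, rootForm_smul_smul]

lemma nuOf_negIdx (P : RootPairing ι ℝ M N) (i : ι) : nuOf P (negIdx P i) = nuOf P i :=
  nuOf_smul P (weylGroup.ofIdx P i) i

lemma two_mul_rootForm_root (P : RootPairing ι ℝ M N) (x : M) (i : ι) :
    2 * P.RootForm x (P.root i) =
      P.RootForm (P.root i) (P.root i) * P.toLinearMap x (P.coroot i) := by
  have h := congrArg (P.toLinearMap x) (P.rootForm_self_smul_coroot i)
  rw [map_smul, smul_eq_mul] at h
  rw [h, map_nsmul, toLinearMap_apply_apply_Polarization, ← P.rootForm_symmetric.eq x]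
  simp

lemma rootForm_root_pos (P : RootPairing ι ℝ M N) (i : ι) :
    0 < P.RootForm (P.root i) (P.root i) :=
  P.rootForm_pos_of_ne_zero (Submodule.subset_span ⟨i, rfl⟩) (P.ne_zero i)

/-- The invariant form and the coroot pairing differ by a positive factor. This moves the question
from coroots to roots, where positive roots are sums of simple ones. -/
lemma wpair_nonneg_of_isDominant {P : RootPairing ι ℝ M N} [P.IsRootSystem] {b : P.Base}
    {x : weightLattice P} (hx : IsDominant b x) {i : ι} (hi : b.IsPos i) : 0 ≤ wpair P x i := by
  have key : ∀ y ∈ AddSubmonoid.closure (P.root '' b.support), 0 ≤ P.RootForm x.1 y := by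
    intro y hy
    induction hy using AddSubmonoid.closure_induction with
    | mem y hy =>
      obtain ⟨j, hj, rfl⟩ := hy
      have h1 := two_mul_rootForm_root P x.1 j
      rw [← wpair_spec] at h1
      have h2 : (0 : ℝ) ≤ wpair P x j := by exact_mod_cast hx ⟨j, hj⟩
      have := mul_nonneg (rootForm_root_pos P j).le h2
      linarith
    | zero => simp
    | add y z _ _ hy hz => rw [map_add]; linarith
  have h1 := two_mul_rootForm_root P x.1 i
  rw [← wpair_spec] at h1
  have h2 := key _ (root_mem_closure_of_isPos b hi)
  have h3 := rootForm_root_pos P i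
  by_contra hneg
  have h4 : ((wpair P x i : ℤ) : ℝ) < 0 := by exact_mod_cast not_le.mp hneg
  nlinarith

lemma wpair_rootWt_pos_iff (P : RootPairing ι ℝ M N) [P.IsCrystallographic] (i j : ι) :
    0 < wpair P (rootWt P i) j ↔ 0 < wpair P (rootWt P j) i := by
  rw [wpair_rootWt_eq, wpair_rootWt_eq]
  exact P.zero_lt_pairingIn_iff' ℤ

end RootCombinatorics

/-! ### Inversion numbers and pairings with ρ^∨, refined by root length, as sums over all roots. -/

section InversionVectors

variable {ι M N : Type*} [AddCommGroup M] [Module ℝ M] [AddCommGroup N] [Module ℝ N]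

open RootPairing

/-- The sign of a root. -/
def rootSign {P : RootPairing ι ℝ M N} (b : P.Base) (i : ι) : ℤ := if b.IsPos i then 1 else -1

lemma rootSign_of_pos {P : RootPairing ι ℝ M N} {b : P.Base} {i : ι} (h : b.IsPos i) :
    rootSign b i = 1 := if_pos h

lemma rootSign_of_not_pos {P : RootPairing ι ℝ M N} {b : P.Base} {i : ι} (h : ¬ b.IsPos i) :
    rootSign b i = -1 := if_neg h

lemma rootSign_negIdx {P : RootPairing ι ℝ M N} (b : P.Base) (i : ι) :
    rootSign b (negIdx P i) = - rootSign b i := by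
  by_cases h : b.IsPos i
  · rw [rootSign_of_pos h, rootSign_of_not_pos]; simpa [isPos_negIdx] using h
  · rw [rootSign_of_not_pos h, rootSign_of_pos]
    · norm_num
    · simpa [isPos_negIdx] using h

lemma rootSign_eq_or {P : RootPairing ι ℝ M N} (b : P.Base) (i : ι) :
    rootSign b i = 1 ∨ rootSign b i = -1 := by
  unfold rootSign; split_ifs <;> simp

lemma rootSign_mul_self {P : RootPairing ι ℝ M N} (b : P.Base) (i : ι) :
    rootSign b i * rootSign b i = 1 := by
  rcases rootSign_eq_or b i with h | h <;> simp [h]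

/-- Up to the factor (α_i, α_g^∨) ≥ 0, the reflection subtracts the positive root y(α_g) from
y(α_i). This lowers the height, so a negative root cannot become positive. -/
lemma rootSign_smul_reflection_le {P : RootPairing ι ℝ M N} [P.IsRootSystem] [P.IsCrystallographic]
    (b : P.Base) (y : P.weylGroup) {g i : ι} (hg : b.IsPos (y • g))
    (hi : 0 ≤ wpair P (rootWt P i) g) :
    rootSign b (y • weylGroup.ofIdx P g • i) ≤ rootSign b (y • i) := by
  by_cases h : b.IsPos (y • weylGroup.ofIdx P g • i)
  · suffices b.IsPos (y • i) by rw [rootSign_of_pos h, rootSign_of_pos this]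
    obtain ⟨ht, hht⟩ := exists_height_functional b
    have e : P.root (y • weylGroup.ofIdx P g • i) =
        P.root (y • i) - (wpair P (rootWt P i) g : ℝ) • P.root (y • g) := by
      rw [root_smul, root_smul, ofIdx_smul_apply, smul_sub, weyl_smul_real, ← root_smul,
        ← root_smul, wpair_spec]
      rfl
    have h2 := congrArg ht e
    rw [map_sub, ht.map_smul, hht, hht, hht, smul_eq_mul] at h2
    have h3 : (0 : ℝ) < b.height (y • weylGroup.ofIdx P g • i) := by exact_mod_cast h
    have h4 : (0 : ℝ) < b.height (y • g) := by exact_mod_cast hg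
    have h5 : (0 : ℝ) ≤ wpair P (rootWt P i) g := by exact_mod_cast hi
    have h6 : (0 : ℝ) < b.height (y • i) := by nlinarith
    exact_mod_cast h6
  · rw [rootSign_of_not_pos h]
    rcases rootSign_eq_or b (y • i) with h' | h' <;> simp [h']

lemma le_rootSign_smul_reflection {P : RootPairing ι ℝ M N} [P.IsRootSystem] [P.IsCrystallographic]
    (b : P.Base) (y : P.weylGroup) {g i : ι} (hg : b.IsPos (y • g))
    (hi : wpair P (rootWt P i) g ≤ 0) :
    rootSign b (y • i) ≤ rootSign b (y • weylGroup.ofIdx P g • i) := by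
  have := rootSign_smul_reflection_le b y (i := negIdx P i) hg
    (by rw [rootWt_negIdx, wpair_neg]; omega)
  simp only [smul_negIdx, rootSign_negIdx] at this
  linarith

variable [Fintype ι]

/-- The unit vector of the length of a root. -/
def lenVec (P : RootPairing ι ℝ M N) (i : ι) : NuR P → ℤ := Pi.single (nuOf P i) 1

lemma lenVec_nonneg (P : RootPairing ι ℝ M N) (i : ι) (ν : NuR P) : 0 ≤ lenVec P i ν := by
  unfold lenVec; by_cases h : ν = nuOf P i
  · subst h; simp
  · simp [h]

lemma lenVec_smul (P : RootPairing ι ℝ M N) (w : P.weylGroup) (i : ι) :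
    lenVec P (w • i) = lenVec P i := by rw [lenVec, nuOf_smul]; rfl

lemma lenVec_negIdx (P : RootPairing ι ℝ M N) (i : ι) : lenVec P (negIdx P i) = lenVec P i := by
  rw [lenVec, nuOf_negIdx]; rfl

/-- The numbers of inversions of `w`, by root lengths. -/
def invVec {P : RootPairing ι ℝ M N} (b : P.Base) (w : P.weylGroup) : NuR P → ℤ :=
  ∑ i ∈ lambdaSet b w, lenVec P i

/-- The pairings with `2 ρ_ν^∨`, as a vector. -/
def twoRhoVec {P : RootPairing ι ℝ M N} (b : P.Base) (x : weightLattice P) : NuR P → ℤ :=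
  fun ν => twoRhoPair b ν x

lemma twoRhoVec_add {P : RootPairing ι ℝ M N} (b : P.Base) (x y : weightLattice P) :
    twoRhoVec b (x + y) = twoRhoVec b x + twoRhoVec b y := by
  funext ν; simp [twoRhoVec, twoRhoPair, wpair_add, Finset.sum_add_distrib]

lemma twoRhoVec_neg {P : RootPairing ι ℝ M N} (b : P.Base) (x : weightLattice P) :
    twoRhoVec b (-x) = - twoRhoVec b x := by
  funext ν; simp [twoRhoVec, twoRhoPair, wpair_neg]

lemma twoRhoVec_sub {P : RootPairing ι ℝ M N} (b : P.Base) (x y : weightLattice P) :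
    twoRhoVec b (x - y) = twoRhoVec b x - twoRhoVec b y := by
  rw [sub_eq_add_neg, twoRhoVec_add, twoRhoVec_neg, sub_eq_add_neg]

/-- Sums over positive roots are doubled to sums over all roots, which can be reindexed by any
element of W; the proofs about inversions below rest on this. -/
lemma sum_eq_two_mul_sum_pos {P : RootPairing ι ℝ M N} (b : P.Base) (F : ι → ℤ)
    (hF : ∀ i, F (negIdx P i) = F i) : ∑ i, F i = 2 * ∑ i with b.IsPos i, F i := by
  rw [← Finset.sum_filter_add_sum_filter_not Finset.univ (fun i => b.IsPos i), two_mul]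
  congr 1
  refine Finset.sum_nbij' (negIdx P) (negIdx P) ?_ ?_ ?_ ?_ ?_
  · intro i; simp [isPos_negIdx]
  · intro i; simp [isPos_negIdx]
  · intro i _; exact negIdx_negIdx P i
  · intro i _; exact negIdx_negIdx P i
  · intro i _; exact (hF i).symm

lemma sum_smul_index {P : RootPairing ι ℝ M N} (w : P.weylGroup) (F : ι → ℤ) :
    ∑ i, F (w • i) = ∑ i, F i :=
  Equiv.sum_comp (MulAction.toPerm w) F

lemma two_mul_twoRhoVec {P : RootPairing ι ℝ M N} (b : P.Base) (x : weightLattice P) (ν : NuR P) :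
    2 * twoRhoVec b x ν = ∑ i, rootSign b i * wpair P x i * lenVec P i ν := by
  rw [sum_eq_two_mul_sum_pos b]
  · congr 1
    rw [twoRhoVec, twoRhoPair, ← Finset.filter_filter, Finset.sum_filter]
    refine Finset.sum_congr rfl fun i hi => ?_
    simp only [Finset.mem_filter, Finset.mem_univ, true_and] at hi
    rw [rootSign_of_pos hi]
    by_cases h2 : nuOf P i = ν
    · subst h2; simp [lenVec]
    · simp [h2, lenVec, Ne.symm h2]
  · intro i
    rw [rootSign_negIdx, wpair_negIdx, lenVec_negIdx]; ring

lemma two_mul_twoRhoVec_smul {P : RootPairing ι ℝ M N} (b : P.Base) (w : P.weylGroup)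
    (x : weightLattice P) (ν : NuR P) :
    2 * twoRhoVec b (w • x) ν = ∑ i, rootSign b (w • i) * wpair P x i * lenVec P i ν := by
  rw [two_mul_twoRhoVec, ← sum_smul_index w]
  simp only [wpair_smul, lenVec_smul]

/-- Each inversion and its negative contribute 2, whence the factor 4. -/
lemma invVec_eq_sum {P : RootPairing ι ℝ M N} (b : P.Base) (w : P.weylGroup) (ν : NuR P) :
    4 * invVec b w ν = ∑ i, (1 - rootSign b i * rootSign b (w • i)) * lenVec P i ν := by
  rw [sum_eq_two_mul_sum_pos b]
  · rw [invVec, lambdaSet, Finset.sum_apply, ← Finset.filter_filter, Finset.sum_filter,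
      Finset.mul_sum, Finset.mul_sum]
    refine Finset.sum_congr rfl fun i hi => ?_
    simp only [Finset.mem_filter, Finset.mem_univ, true_and] at hi
    rw [rootSign_of_pos hi]
    by_cases h : b.IsPos (w • i)
    · simp [h, rootSign_of_pos]
    · simp only [h, not_false_eq_true, if_true, rootSign_of_not_pos]; ring
  · intro i
    rw [smul_negIdx, rootSign_negIdx, rootSign_negIdx, lenVec_negIdx]; ring

lemma invVec_inv {P : RootPairing ι ℝ M N} (b : P.Base) (w : P.weylGroup) :
    invVec b w⁻¹ = invVec b w := by
  funext ν
  have h1 := invVec_eq_sum b w⁻¹ ν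
  have h2 := invVec_eq_sum b w ν
  rw [← sum_smul_index w] at h1
  simp only [inv_smul_smul, lenVec_smul, mul_comm (rootSign b (w • _))] at h1
  omega

lemma invVec_one {P : RootPairing ι ℝ M N} (b : P.Base) : invVec b 1 = 0 := by
  funext ν
  have h2 := invVec_eq_sum b 1 ν
  simp only [one_smul, rootSign_mul_self] at h2
  simpa using h2

lemma four_mul_invVec_sub {P : RootPairing ι ℝ M N} (b : P.Base) (w : P.weylGroup) (g : ι)
    (ν : NuR P) :
    4 * (invVec b (w * weylGroup.ofIdx P g) ν - invVec b w ν) =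
      ∑ i, (rootSign b i - rootSign b (weylGroup.ofIdx P g • i)) * rootSign b (w • i) *
        lenVec P i ν := by
  have h1 := invVec_eq_sum b (w * weylGroup.ofIdx P g) ν
  have h2 := invVec_eq_sum b w ν
  rw [← sum_smul_index (weylGroup.ofIdx P g)] at h1
  simp only [smul_smul, mul_assoc, ofIdx_mul_self, mul_one, lenVec_smul] at h1
  rw [mul_sub, h1, h2, ← Finset.sum_sub_distrib]
  refine Finset.sum_congr rfl fun i _ => ?_
  ring

/-- The preceding formula is added to its reindexing by s_g, so that both sign differences appear in
each summand. -/
lemma eight_mul_invVec_sub {P : RootPairing ι ℝ M N} (b : P.Base) (w : P.weylGroup) (g : ι)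
    (ν : NuR P) :
    8 * (invVec b (w * weylGroup.ofIdx P g) ν - invVec b w ν) =
      ∑ i, (rootSign b i - rootSign b (weylGroup.ofIdx P g • i)) *
        (rootSign b (w • i) - rootSign b (w • weylGroup.ofIdx P g • i)) * lenVec P i ν := by
  have h1 := four_mul_invVec_sub b w g ν
  have h2 := h1
  rw [← sum_smul_index (weylGroup.ofIdx P g)] at h2
  simp only [lenVec_smul] at h2
  have h3 : ∀ i : ι, weylGroup.ofIdx P g • weylGroup.ofIdx P g • i = i := fun i => by
    rw [smul_smul, ofIdx_mul_self, one_smul]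
  simp only [h3] at h2
  rw [show (8 : ℤ) = 4 + 4 by norm_num, add_mul]
  nth_rewrite 1 [h1]
  rw [h2, ← Finset.sum_add_distrib]
  refine Finset.sum_congr rfl fun i _ => ?_
  ring

section Crystallographic

variable {P : RootPairing ι ℝ M N} [P.IsCrystallographic]

/-- Since s_g negates the root g, the pairing is half the difference of its values at g and s_g(g),
and this brings in the same sign differences as for inversions. -/
lemma four_mul_twoRhoVec_root (b : P.Base) (g : ι) (ν : NuR P) :
    4 * twoRhoVec b (rootWt P g) ν =
      ∑ i, (rootSign b i - rootSign b (weylGroup.ofIdx P g • i)) * wpair P (rootWt P g) i *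
        lenVec P i ν := by
  have h1 := two_mul_twoRhoVec b (rootWt P g) ν
  have h2 := two_mul_twoRhoVec_smul b (weylGroup.ofIdx P g) (rootWt P g) ν
  rw [smul_rootWt, ofIdx_smul_self, rootWt_negIdx, twoRhoVec_neg, Pi.neg_apply] at h2
  have h3 : 4 * twoRhoVec b (rootWt P g) ν =
    2 * twoRhoVec b (rootWt P g) ν - 2 * -twoRhoVec b (rootWt P g) ν := by ring
  rw [h3, h1, h2, ← Finset.sum_sub_distrib]
  refine Finset.sum_congr rfl fun i _ => ?_
  ring

lemma add_le_sum_of_pair (g : ι) (F : ι → ℤ) (hF : ∀ i, 0 ≤ F i) :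
    F g + F (negIdx P g) ≤ ∑ i, F i := by
  exact Finset.add_le_sum (fun i _ => hF i) (Finset.mem_univ _) (Finset.mem_univ _)
    (negIdx_ne P g).symm

variable [P.IsRootSystem]

/-- If the pairing were not positive, s_g would add a non-negative multiple of a positive root and
could not make i negative. -/
lemma wpair_pos_of_inversion {b : P.Base} {g i : ι} (hg : b.IsPos g) (hi : b.IsPos i)
    (h : ¬ b.IsPos (weylGroup.ofIdx P g • i)) : 0 < wpair P (rootWt P g) i := by
  rw [wpair_rootWt_pos_iff]
  by_contra hn
  have := le_rootSign_smul_reflection b 1 (g := g) (i := i) (by simpa using hg) (not_lt.mp hn)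
  rw [one_smul, one_smul, rootSign_of_pos hi, rootSign_of_not_pos h] at this
  omega

lemma wpair_neg_of_inversion {b : P.Base} {g i : ι} (hg : b.IsPos g) (hi : ¬ b.IsPos i)
    (h : b.IsPos (weylGroup.ofIdx P g • i)) : wpair P (rootWt P g) i < 0 := by
  have := wpair_pos_of_inversion (b := b) (g := g) (i := negIdx P i) hg
    (by simpa [isPos_negIdx] using hi) (by simpa [isPos_negIdx, smul_negIdx] using h)
  rw [wpair_negIdx] at this
  omega

/-- Reflections in positive roots lower the inversion numbers by at most `2 ρ^∨`. -/
lemma lenVec_sub_le_invVec_sub (b : P.Base) (w : P.weylGroup) {g : ι} (hg : b.IsPos g)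
    (ν : NuR P) :
    lenVec P g ν - twoRhoVec b (rootWt P g) ν ≤
      invVec b (w * weylGroup.ofIdx P g) ν - invVec b w ν := by
  have h1 := four_mul_invVec_sub b w g ν
  have h2 := four_mul_twoRhoVec_root b g ν
  -- The sum of the two formulas. A summand is nonzero only if s_g changes the sign of i; then (g,
  -- i^∨) has the sign of the first factor and absolute value at least 1, which outweighs the sign
  -- of w(i).
  set F : ι → ℤ := fun i => (rootSign b i - rootSign b (weylGroup.ofIdx P g • i)) *
    (rootSign b (w • i) + wpair P (rootWt P g) i) * lenVec P i ν with hFdef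
  have h3 : 4 * (invVec b (w * weylGroup.ofIdx P g) ν - invVec b w ν) +
      4 * twoRhoVec b (rootWt P g) ν = ∑ i, F i := by
    rw [h1, h2, ← Finset.sum_add_distrib]
    exact Finset.sum_congr rfl fun i _ => by rw [hFdef]; ring
  have hF : ∀ i, 0 ≤ F i := by
    intro i
    refine mul_nonneg ?_ (lenVec_nonneg P i ν)
    by_cases hi : b.IsPos i <;> by_cases h : b.IsPos (weylGroup.ofIdx P g • i)
    · rw [rootSign_of_pos hi, rootSign_of_pos h]; simp
    · rw [rootSign_of_pos hi, rootSign_of_not_pos h]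
      have := wpair_pos_of_inversion hg hi h
      rcases rootSign_eq_or b (w • i) with h' | h' <;> rw [h'] <;> omega
    · rw [rootSign_of_not_pos hi, rootSign_of_pos h]
      have := wpair_neg_of_inversion hg hi h
      rcases rootSign_eq_or b (w • i) with h' | h' <;> rw [h'] <;> omega
    · rw [rootSign_of_not_pos hi, rootSign_of_not_pos h]; simp
  have h4 := add_le_sum_of_pair (P := P) g F hF
  -- For ±g the pairing is ±2, so these two terms give 4(2 ± 1) unit vectors.
  have h5 : 4 * lenVec P g ν ≤ F g + F (negIdx P g) := by
    simp only [hFdef, smul_negIdx, rootSign_negIdx, lenVec_negIdx, wpair_negIdx, ofIdx_smul_self,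
      wpair_rootWt_self, rootSign_of_pos hg]
    have := lenVec_nonneg P g ν
    rcases rootSign_eq_or b (w • g) with h' | h' <;> rw [h'] <;> linarith
  linarith

/-- This refines ℓ(w s_g) > ℓ(w) by root length. The sign of (i, g^∨) determines the direction in
which s_g can change both the sign of i and that of w(i), so the two differences never have opposite
signs; the terms ±g supply the unit vector. -/
lemma le_invVec_sub_of_pos (b : P.Base) (w : P.weylGroup) {g : ι} (hg : b.IsPos g)
    (hw : b.IsPos (w • g)) (ν : NuR P) :
    lenVec P g ν ≤ invVec b (w * weylGroup.ofIdx P g) ν - invVec b w ν := by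
  have h1 := eight_mul_invVec_sub b w g ν
  set F : ι → ℤ := fun i => (rootSign b i - rootSign b (weylGroup.ofIdx P g • i)) *
    (rootSign b (w • i) - rootSign b (w • weylGroup.ofIdx P g • i)) * lenVec P i ν with hFdef
  have hF : ∀ i, 0 ≤ F i := by
    intro i
    refine mul_nonneg ?_ (lenVec_nonneg P i ν)
    rcases le_total 0 (wpair P (rootWt P i) g) with h | h
    · have h2 := rootSign_smul_reflection_le b w hw h
      have h3 := rootSign_smul_reflection_le b 1 (g := g) (by simpa using hg) h
      rw [one_smul, one_smul] at h3
      exact mul_nonneg (by linarith) (by linarith)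
    · have h2 := le_rootSign_smul_reflection b w hw h
      have h3 := le_rootSign_smul_reflection b 1 (g := g) (by simpa using hg) h
      rw [one_smul, one_smul] at h3
      exact mul_nonneg_of_nonpos_of_nonpos (by linarith) (by linarith)
  have h4 := add_le_sum_of_pair (P := P) g F hF
  have h5 : F g + F (negIdx P g) = 8 * lenVec P g ν := by
    simp only [hFdef, smul_negIdx, rootSign_negIdx, lenVec_negIdx, ofIdx_smul_self, negIdx_negIdx,
      rootSign_of_pos hg, rootSign_of_pos hw]
    ring
  linarith

/-- `2 (ρ_ν^∨, α)` is at least `2` for a positive root `α` with `ν_α = ν`, and non-negative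
otherwise. -/
lemma two_mul_lenVec_le_twoRhoVec (b : P.Base) {g : ι} (hg : b.IsPos g) (ν : NuR P) :
    2 * lenVec P g ν ≤ twoRhoVec b (rootWt P g) ν := by
  have h1 := four_mul_twoRhoVec_root b g ν
  set F : ι → ℤ := fun i => (rootSign b i - rootSign b (weylGroup.ofIdx P g • i)) *
    wpair P (rootWt P g) i * lenVec P i ν with hFdef
  have hF : ∀ i, 0 ≤ F i := by
    intro i
    refine mul_nonneg ?_ (lenVec_nonneg P i ν)
    by_cases hi : b.IsPos i <;> by_cases h : b.IsPos (weylGroup.ofIdx P g • i)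
    · rw [rootSign_of_pos hi, rootSign_of_pos h]; simp
    · rw [rootSign_of_pos hi, rootSign_of_not_pos h]
      have := wpair_pos_of_inversion hg hi h
      omega
    · rw [rootSign_of_not_pos hi, rootSign_of_pos h]
      have := wpair_neg_of_inversion hg hi h
      omega
    · rw [rootSign_of_not_pos hi, rootSign_of_not_pos h]; simp
  have h4 := add_le_sum_of_pair (P := P) g F hF
  have h5 : F g + F (negIdx P g) = 8 * lenVec P g ν := by
    simp only [hFdef, smul_negIdx, rootSign_negIdx, lenVec_negIdx, wpair_negIdx, ofIdx_smul_self,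
      wpair_rootWt_self, rootSign_of_pos hg]
    ring
  linarith

/-- The left version: reflections in positive roots multiplied from the left. -/
lemma lenVec_sub_le_invVec_sub_left (b : P.Base) (z : P.weylGroup) {g : ι} (hg : b.IsPos g)
    (ν : NuR P) :
    lenVec P g ν - twoRhoVec b (rootWt P g) ν ≤
      invVec b (weylGroup.ofIdx P g * z) ν - invVec b z ν := by
  have := lenVec_sub_le_invVec_sub b z⁻¹ hg ν
  rw [← invVec_inv b z, ← invVec_inv b (_ * z), mul_inv_rev, ofIdx_inv]
  exact this

lemma le_invVec_sub_of_pos_left (b : P.Base) (z : P.weylGroup) {g : ι} (hg : b.IsPos g)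
    (hz : b.IsPos (z⁻¹ • g)) (ν : NuR P) :
    lenVec P g ν ≤ invVec b (weylGroup.ofIdx P g * z) ν - invVec b z ν := by
  have := le_invVec_sub_of_pos b z⁻¹ hg hz ν
  rw [← invVec_inv b z, ← invVec_inv b (_ * z), mul_inv_rev, ofIdx_inv]
  exact this

variable [P.IsReduced]

lemma isPos_simple_reflection {b : P.Base} (j : b.support) {i : ι} (hi : b.IsPos i) (hij : i ≠ j) :
    b.IsPos (simpleRefl b j • i) := hi.reflectionPerm j.2 hij

lemma isPos_simple {b : P.Base} (j : b.support) : b.IsPos j := b.isPos_of_mem_support j.2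

/-- A simple reflection permutes the positive roots other than its own, so only the two roots ±α_j
contribute. -/
lemma invVec_mul_simple (b : P.Base) (w : P.weylGroup) (j : b.support) :
    invVec b (w * simpleRefl b j) = invVec b w + rootSign b (w • (j : ι)) • lenVec P j := by
  funext ν
  have h1 := four_mul_invVec_sub b w j ν
  rw [← Finset.sum_subset (Finset.subset_univ {(j : ι), negIdx P j}),
    Finset.sum_pair (negIdx_ne P _).symm] at h1
  · simp only [smul_negIdx, rootSign_negIdx, lenVec_negIdx, ofIdx_smul_self,
      rootSign_of_pos (isPos_simple j)] at h1
    simp only [Pi.add_apply, Pi.smul_apply, smul_eq_mul]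
    linarith
  · intro i _ hi
    simp only [Finset.mem_insert, Finset.mem_singleton, not_or] at hi
    by_cases h : b.IsPos i
    · have h2 := isPos_simple_reflection j h hi.1
      rw [rootSign_of_pos h, rootSign_of_pos h2]; simp
    · have h2 := isPos_simple_reflection j ((isPos_negIdx b i).mpr h) (fun e => hi.2 (by
        rw [← e, negIdx_negIdx]))
      rw [smul_negIdx, isPos_negIdx] at h2
      rw [rootSign_of_not_pos h, rootSign_of_not_pos h2]; simp

end Crystallographic

end InversionVectors

/-! ### Reduced words, longest elements and the geometry of dominant weights. -/

section Words

variable {ι M N : Type*} [AddCommGroup M] [Module ℝ M] [AddCommGroup N] [Module ℝ N]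

open RootPairing

variable {P : RootPairing ι ℝ M N}

lemma wordProd_nil (b : P.Base) : wordProd b [] = 1 := rfl

lemma wordProd_cons (b : P.Base) (j : b.support) (l : List b.support) :
    wordProd b (j :: l) = simpleRefl b j * wordProd b l := by simp [wordProd]

lemma wordProd_append (b : P.Base) (l l' : List b.support) :
    wordProd b (l ++ l') = wordProd b l * wordProd b l' := by simp [wordProd]

lemma wordProd_reverse (b : P.Base) (l : List b.support) :
    wordProd b l.reverse = (wordProd b l)⁻¹ := by
  induction l with
  | nil => simp [wordProd]
  | cons j l ih =>
    rw [List.reverse_cons, wordProd_append, ih, wordProd_cons, wordProd_cons, mul_inv_rev,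
      wordProd_nil, mul_one, ofIdx_inv]

lemma IsReducedWord.reverse {b : P.Base} {l : List b.support} {w : P.weylGroup}
    (h : IsReducedWord b l w) : IsReducedWord b l.reverse w⁻¹ := by
  refine ⟨by rw [wordProd_reverse, h.1], fun l' hl' => ?_⟩
  have := h.2 l'.reverse (by rw [wordProd_reverse, hl', inv_inv])
  simpa using this

variable [Fintype ι] [P.IsRootSystem] [P.IsCrystallographic] [P.IsReduced]

/-- The simple reflections generate the Weyl group. -/
lemma exists_wordProd_eq (b : P.Base) (w : P.weylGroup) : ∃ l, wordProd b l = w := by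
  have href : ∀ i, ∃ l, wordProd b l = weylGroup.ofIdx P i := by
    intro i
    induction i using b.induction_reflect with
    | h₀ i ih => rwa [← ofIdx_negIdx] at ih
    | h₁ i hi => exact ⟨[⟨i, hi⟩], by simp [wordProd]⟩
    | h₂ i j ih hj =>
      obtain ⟨l, hl⟩ := ih
      refine ⟨⟨j, hj⟩ :: (l ++ [⟨j, hj⟩]), ?_⟩
      have h1 := conj_ofIdx P (weylGroup.ofIdx P j) i
      rw [ofIdx_inv, ofIdx_smul_index] at h1
      rw [wordProd_cons, wordProd_append, hl, wordProd_cons, wordProd_nil, mul_one, ← h1, mul_assoc]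
  obtain ⟨w, hw⟩ := w
  induction hw using weylGroup.induction with
  | mem i => exact href i
  | one => exact ⟨[], rfl⟩
  | mul x y hx hy h1 h2 =>
    obtain ⟨l1, h1⟩ := h1
    obtain ⟨l2, h2⟩ := h2
    exact ⟨l1 ++ l2, by rw [wordProd_append, h1, h2]; rfl⟩

lemma exists_isReducedWord (b : P.Base) (w : P.weylGroup) : ∃ l, IsReducedWord b l w := by
  have hne : {n | ∃ l : List b.support, wordProd b l = w ∧ l.length = n}.Nonempty := by
    obtain ⟨l, hl⟩ := exists_wordProd_eq b w
    exact ⟨_, l, hl, rfl⟩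
  obtain ⟨l, hl, hn⟩ := Nat.sInf_mem hne
  exact ⟨l, hl, fun l' hl' => hn ▸ Nat.sInf_le ⟨l', hl', rfl⟩⟩

lemma len_eq_length {b : P.Base} {l : List b.support} {w : P.weylGroup}
    (h : IsReducedWord b l w) : len b w = l.length := by
  refine le_antisymm (Nat.sInf_le ⟨l, h.1, rfl⟩) ?_
  refine le_csInf ⟨_, l, h.1, rfl⟩ ?_
  rintro n ⟨l', hl', rfl⟩
  exact h.2 l' hl'

/-- The exchange property. -/
lemma exists_shorter_word {b : P.Base} (l : List b.support) {β : ι} (hβ : b.IsPos β)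
    (h : ¬ b.IsPos ((wordProd b l)⁻¹ • β)) :
    ∃ l' : List b.support, l'.length + 1 = l.length ∧
      wordProd b l' = weylGroup.ofIdx P β * wordProd b l := by
  induction l generalizing β with
  | nil => simp [wordProd_nil, hβ] at h
  | cons k l ih =>
    rw [wordProd_cons, mul_inv_rev, ofIdx_inv, mul_smul] at h
    by_cases hk : β = k
    · subst hk
      exact ⟨l, rfl, by rw [wordProd_cons, ← mul_assoc, ofIdx_mul_self, one_mul]⟩
    -- Because s_β s_k = s_k s_γ with γ = s_k(β), still positive, the letter to be deleted lies
    -- further to the right.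
    · obtain ⟨l', hl', h'⟩ := ih (isPos_simple_reflection k hβ hk) h
      refine ⟨k :: l', by simp [hl'], ?_⟩
      rw [wordProd_cons, wordProd_cons, h', ← mul_assoc, mul_ofIdx, smul_smul, ofIdx_mul_self,
        one_smul, mul_assoc]

/-- Otherwise the exchange property absorbs the letter j into a shortened suffix, and the whole word
is two letters too long. -/
lemma IsReducedWord.isPos_suffix {b : P.Base} {l₁ l₂ : List b.support} {j : b.support}
    {w : P.weylGroup} (h : IsReducedWord b (l₁ ++ j :: l₂) w) :
    b.IsPos ((wordProd b l₂)⁻¹ • (j : ι)) := by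
  by_contra hn
  obtain ⟨l', hl', h'⟩ := exists_shorter_word l₂ (isPos_simple j) hn
  have := h.2 (l₁ ++ l') (by rw [← h.1, wordProd_append, wordProd_append, h', wordProd_cons])
  simp at this
  omega

lemma IsReducedWord.isPos_prefix {b : P.Base} {l₁ l₂ : List b.support} {j : b.support}
    {w : P.weylGroup} (h : IsReducedWord b (l₁ ++ j :: l₂) w) :
    b.IsPos (wordProd b l₁ • (j : ι)) := by
  have h2 := h.reverse
  rw [List.reverse_append, List.reverse_cons, List.append_assoc, List.singleton_append] at h2
  have := IsReducedWord.isPos_suffix h2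
  rwa [wordProd_reverse, inv_inv] at this

omit [P.IsRootSystem] [P.IsCrystallographic] [P.IsReduced] in
lemma sum_lenVec (i : ι) : ∑ ν, lenVec P i ν = 1 := by simp [lenVec]

lemma sum_invVec_wordProd {b : P.Base} {l : List b.support}
    (h : ∀ l₁ (j : b.support) l₂, l = l₁ ++ j :: l₂ → b.IsPos (wordProd b l₁ • (j : ι))) :
    ∑ ν, invVec b (wordProd b l) ν = l.length := by
  induction l using List.reverseRecOn with
  | nil => simp [wordProd_nil, invVec_one]
  | append_singleton l j ih =>
    have h1 := h l j [] rfl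
    rw [wordProd_append, wordProd_cons, wordProd_nil, mul_one, invVec_mul_simple,
      rootSign_of_pos h1]
    simp only [one_smul, Pi.add_apply, Finset.sum_add_distrib, sum_lenVec]
    rw [ih fun l₁ k l₂ hl => h l₁ k (l₂ ++ [j]) (by simp [hl])]
    simp

/-- Along a reduced word each letter creates exactly one inversion. This converts the vector
estimates into statements about length. -/
lemma len_eq_sum_invVec (b : P.Base) (w : P.weylGroup) : (len b w : ℤ) = ∑ ν, invVec b w ν := by
  obtain ⟨l, hl⟩ := exists_isReducedWord b w
  rw [len_eq_length hl, ← hl.1]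
  refine (sum_invVec_wordProd fun l₁ j l₂ h => ?_).symm
  rw [h] at hl
  exact hl.isPos_prefix

/-- Otherwise multiplication by s_i would give a longer element of the same subgroup. -/
lemma not_isPos_longest_smul (b : P.Base) (H : Subgroup P.weylGroup) {i : ι} (hi : b.IsPos i)
    (hH : weylGroup.ofIdx P i ∈ H) : ¬ b.IsPos (longest b H • i) := by
  intro h
  have hmax := (Finite.exists_max fun w : H => len b w.1).choose_spec
    ((Finite.exists_max fun w : H => len b w.1).choose * ⟨_, hH⟩)
  change len b (longest b H * weylGroup.ofIdx P i) ≤ len b (longest b H) at hmax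
  have h1 := len_eq_sum_invVec b (longest b H * weylGroup.ofIdx P i)
  have h2 := len_eq_sum_invVec b (longest b H)
  have h3 : ∑ ν, lenVec P i ν ≤
      ∑ ν, (invVec b (longest b H * weylGroup.ofIdx P i) ν - invVec b (longest b H) ν) :=
    Finset.sum_le_sum fun ν _ => le_invVec_sub_of_pos b _ hi h ν
  rw [sum_lenVec, Finset.sum_sub_distrib] at h3
  omega

lemma longest_mem (b : P.Base) (H : Subgroup P.weylGroup) : longest b H ∈ H :=
  ((Finite.exists_max fun w : H => len b w.1).choose).2

/-- For dominant `x`, the inversions of `u_x` are the positive roots `α` with `(x, α^∨) > 0`. -/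
lemma mem_lambdaSet_uElt {b : P.Base} {x : weightLattice P} (hx : IsDominant b x) (i : ι) :
    i ∈ lambdaSet b (uElt b x) ↔ b.IsPos i ∧ 0 < wpair P x i := by
  simp only [lambdaSet, Finset.mem_filter, Finset.mem_univ, true_and]
  refine and_congr_right fun hi => ?_
  set w := longest b (MulAction.stabilizer P.weylGroup x) with hw
  have hfix : w • x = x := longest_mem b (MulAction.stabilizer P.weylGroup x)
  have htop : ∀ k, b.IsPos (longest b ⊤ • k) ↔ ¬ b.IsPos k := by
    intro k
    refine ⟨fun h hk => not_isPos_longest_smul b ⊤ hk trivial h, fun hk => ?_⟩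
    have := not_isPos_longest_smul b ⊤ ((isPos_negIdx b k).mpr hk) trivial
    rwa [smul_negIdx, isPos_negIdx, not_not] at this
  have hpair : wpair P x (w • i) = wpair P x i := by
    nth_rewrite 1 [← hfix]; exact wpair_smul P w x i
  rw [uElt, mul_smul, htop, not_not]
  constructor
  · intro h
    -- If the pairing were 0, s_i would fix x, and the longest element of the stabilizer would make
    -- i negative.
    refine lt_of_le_of_ne (wpair_nonneg_of_isDominant hx hi) fun h0 => ?_
    refine not_isPos_longest_smul b (MulAction.stabilizer P.weylGroup x) hi ?_ h
    rw [MulAction.mem_stabilizer_iff, ofIdx_smul_weight, ← h0, zero_smul, sub_zero]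
  · intro h
    by_contra hn
    have := wpair_nonneg_of_isDominant hx ((isPos_negIdx b _).mpr hn)
    rw [wpair_negIdx, hpair] at this
    omega

/-- The inversions of (s_j v)⁻¹ are α_j together with the s_j-images of those of v⁻¹. This matches
the recursion for T_w. -/
lemma prod_lambdaSet_inv_cons {b : P.Base} {K : Type*} [CommMonoid K] (F : ι → K) {j : b.support}
    {v : P.weylGroup} (h : b.IsPos (v⁻¹ • (j : ι))) :
    ∏ i ∈ lambdaSet b (simpleRefl b j * v)⁻¹, F i =
      F j * ∏ i ∈ lambdaSet b v⁻¹, F (simpleRefl b j • i) := by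
  have hinv : ∀ i : ι, simpleRefl b j • simpleRefl b j • i = i := fun i => by
    rw [smul_smul, ofIdx_mul_self, one_smul]
  have hmem : (j : ι) ∈ lambdaSet b (simpleRefl b j * v)⁻¹ := by
    simp only [lambdaSet, Finset.mem_filter, Finset.mem_univ, true_and]
    refine ⟨isPos_simple j, ?_⟩
    rw [mul_inv_rev, ofIdx_inv, mul_smul, ofIdx_smul_self, smul_negIdx, isPos_negIdx, not_not]
    exact h
  rw [← Finset.mul_prod_erase _ _ hmem]
  congr 1
  refine Finset.prod_nbij' (simpleRefl b j • ·) (simpleRefl b j • ·) ?_ ?_ ?_ ?_ ?_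
  · intro i hi
    simp only [lambdaSet, Finset.mem_erase, Finset.mem_filter, Finset.mem_univ, true_and,
      mul_inv_rev, ofIdx_inv, mul_smul] at hi ⊢
    exact ⟨isPos_simple_reflection j hi.2.1 hi.1, hi.2.2⟩
  · intro i hi
    simp only [lambdaSet, Finset.mem_erase, Finset.mem_filter, Finset.mem_univ, true_and,
      mul_inv_rev, ofIdx_inv, mul_smul, hinv] at hi ⊢
    have hij : i ≠ j := by rintro rfl; exact hi.2 h
    have hpos := isPos_simple_reflection j hi.1 hij
    refine ⟨fun e => ?_, hpos, hi.2⟩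
    have e2 : i = negIdx P j := by rw [← hinv i, e, ofIdx_smul_self]
    have := hi.1
    rw [e2, isPos_negIdx] at this
    exact this (isPos_simple j)
  · intro i _; exact hinv i
  · intro i _; exact hinv i
  · intro i _; rw [hinv]

/-- The difference of the two sides is a sum of non-negative terms, so all of them vanish. The last
letter j of a reduced word of u has u(α_j) < 0, and its term forces (x, α_j^∨) = 0. So s_j fixes x
and can be dropped. -/
lemma smul_eq_self_of_twoRhoVec_eq {b : P.Base} {x : weightLattice P} (hx : IsDominant b x)
    (u : P.weylGroup) (h : twoRhoVec b (u • x) = twoRhoVec b x) : u • x = x := by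
  obtain ⟨l, hl⟩ := exists_isReducedWord b u
  have hgood : ∀ l₁ (j : b.support) l₂, l = l₁ ++ j :: l₂ → b.IsPos (wordProd b l₁ • (j : ι)) := by
    intro l₁ j l₂ e
    rw [e] at hl
    exact hl.isPos_prefix
  rw [← hl.1] at h ⊢
  clear hl
  induction l using List.reverseRecOn with
  | nil => rw [wordProd_nil, one_smul]
  | append_singleton l j ih =>
    have h1 := hgood l j [] rfl
    rw [wordProd_append, wordProd_cons, wordProd_nil, mul_one] at h ⊢
    set w := wordProd b l
    suffices h2 : wpair P x j = 0 by
      have h3 : simpleRefl b j • x = x := by rw [ofIdx_smul_weight, h2, zero_smul, sub_zero]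
      rw [mul_smul, h3] at h ⊢
      exact ih h fun l₁ k l₂ e => hgood l₁ k (l₂ ++ [j]) (by simp [e])
    have hν := congrFun h (nuOf P j)
    have e1 := two_mul_twoRhoVec_smul b (w * simpleRefl b j) x (nuOf P j)
    have e2 := two_mul_twoRhoVec b x (nuOf P j)
    set F : ι → ℤ := fun i => (rootSign b i - rootSign b ((w * simpleRefl b j) • i)) *
      wpair P x i * lenVec P i (nuOf P j) with hF
    have e3 : ∑ i, F i = 0 := by
      have : ∑ i, F i = 2 * twoRhoVec b x (nuOf P j) -
          2 * twoRhoVec b ((w * simpleRefl b j) • x) (nuOf P j) := by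
        rw [e1, e2, ← Finset.sum_sub_distrib]
        exact Finset.sum_congr rfl fun i _ => by rw [hF]; ring
      rw [this, hν]; ring
    have hnn : ∀ i, 0 ≤ F i := by
      intro i
      refine mul_nonneg ?_ (lenVec_nonneg P i _)
      by_cases hi : b.IsPos i
      · have := wpair_nonneg_of_isDominant hx hi
        rw [rootSign_of_pos hi]
        refine mul_nonneg ?_ this
        rcases rootSign_eq_or b ((w * simpleRefl b j) • i) with h' | h' <;> simp [h']
      · have := wpair_nonneg_of_isDominant hx ((isPos_negIdx b i).mpr hi)
        rw [wpair_negIdx] at this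
        rw [rootSign_of_not_pos hi]
        refine mul_nonneg_of_nonpos_of_nonpos ?_ (by linarith)
        rcases rootSign_eq_or b ((w * simpleRefl b j) • i) with h' | h' <;> simp [h']
    have e4 := (Finset.sum_eq_zero_iff_of_nonneg fun i _ => hnn i).mp e3 j (Finset.mem_univ _)
    simp only [hF, mul_smul, ofIdx_smul_self, smul_negIdx, rootSign_negIdx, rootSign_of_pos h1,
      rootSign_of_pos (isPos_simple j)] at e4
    simp [lenVec] at e4
    exact e4

omit [P.IsReduced] [P.IsCrystallographic] in
lemma twoRhoVec_smul_le {b : P.Base} {x : weightLattice P} (hx : IsDominant b x)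
    (u : P.weylGroup) : twoRhoVec b (u • x) ≤ twoRhoVec b x := by
  intro ν
  have e1 := two_mul_twoRhoVec_smul b u x ν
  have e2 := two_mul_twoRhoVec b x ν
  have : 2 * twoRhoVec b (u • x) ν ≤ 2 * twoRhoVec b x ν := by
    rw [e1, e2]
    refine Finset.sum_le_sum fun i _ => mul_le_mul_of_nonneg_right ?_ (lenVec_nonneg P i ν)
    by_cases hi : b.IsPos i
    · refine mul_le_mul_of_nonneg_right ?_ (wpair_nonneg_of_isDominant hx hi)
      rw [rootSign_of_pos hi]
      rcases rootSign_eq_or b (u • i) with h' | h' <;> simp [h']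
    · have := wpair_nonneg_of_isDominant hx ((isPos_negIdx b i).mpr hi)
      rw [wpair_negIdx] at this
      refine mul_le_mul_of_nonpos_right ?_ (by linarith)
      rw [rootSign_of_not_pos hi]
      rcases rootSign_eq_or b (u • i) with h' | h' <;> simp [h']
  linarith

/-! ### The maximal short root. -/

section MaximalShortRoot

variable {b : P.Base} {θ : ι}

omit [P.IsCrystallographic] [P.IsReduced] in
lemma IsMaximalShortRoot.isPos (h : IsMaximalShortRoot b θ) : b.IsPos θ := by
  obtain ⟨ht, hht⟩ := exists_height_functional b
  have h1 := height_nonneg_of_mem_closure hht (h.2 (negIdx P θ) (by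
    rw [← h.1]; exact congrArg Subtype.val (nuOf_negIdx P θ)))
  rw [root_negIdx, sub_neg_eq_add, map_add, hht] at h1
  rw [Base.isPos_iff']
  have : (0 : ℝ) ≤ b.height θ := by linarith
  exact_mod_cast this

omit [P.IsReduced] in
-- The root s_j(ϑ) is short, so ϑ - s_j(ϑ) = (ϑ, α_j^∨) α_j lies in Q₊ and has non-negative height.
lemma IsMaximalShortRoot.isDominant (h : IsMaximalShortRoot b θ) :
    IsDominant b (rootWt P θ) := by
  intro j
  obtain ⟨ht, hht⟩ := exists_height_functional b
  have h1 := height_nonneg_of_mem_closure hht (h.2 (simpleRefl b j • θ) (by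
    rw [← h.1]; exact congrArg Subtype.val (nuOf_smul P _ θ)))
  rw [root_smul, ofIdx_smul_apply, sub_sub_cancel, ht.map_smul, hht,
    Base.height_one_of_mem_support j.2, P.root_coroot_eq_pairing, ← wpair_rootWt] at h1
  simp only [Int.cast_one, smul_eq_mul, mul_one] at h1
  exact_mod_cast h1

omit [P.IsRootSystem] [P.IsCrystallographic] [P.IsReduced] in
lemma rootForm_le_of_nu_eq_one (h : nu P θ = 1) (i : ι) :
    P.RootForm (P.root θ) (P.root θ) ≤ P.RootForm (P.root i) (P.root i) := by
  rw [nu, div_eq_one_iff_eq] at h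
  · rw [h]
    exact ciInf_le (Set.finite_range _).bddBelow i
  -- If the infimum were 0, the quotient would be 0 by convention, not 1.
  · intro h0
    rw [h0, div_zero] at h
    norm_num at h

/-- As ϑ is not longer than i, a pairing (ϑ, i^∨) ≥ 2 would force (i, ϑ^∨) ≥ 2 as well. This is
impossible for two non-proportional roots. -/
lemma IsMaximalShortRoot.wpair_le_one (h : IsMaximalShortRoot b θ) {i : ι} (hi : b.IsPos i)
    (hne : i ≠ θ) : wpair P (rootWt P θ) i ≤ 1 := by
  by_contra hlt
  have h1 := two_mul_rootForm_root P (P.root θ) i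
  have h2 := two_mul_rootForm_root P (P.root i) θ
  rw [P.root_coroot_eq_pairing, ← wpair_rootWt] at h1 h2
  have hsymm : P.RootForm (P.root i) (P.root θ) = P.RootForm (P.root θ) (P.root i) :=
    (by simpa using (P.rootForm_symmetric.eq (P.root θ) (P.root i)).symm)
  have hle := rootForm_le_of_nu_eq_one h.1 i
  have hpos := rootForm_root_pos P θ
  have h3 : (2 : ℝ) ≤ wpair P (rootWt P θ) i := by
    have : 2 ≤ wpair P (rootWt P θ) i := by omega
    exact_mod_cast this
  have h4 : (2 : ℝ) ≤ wpair P (rootWt P i) θ := by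
    by_contra hc
    nlinarith
  have h5 : 2 ≤ wpair P (rootWt P i) θ := by exact_mod_cast h4
  have hmem := P.pairingIn_pairingIn_mem_set_of_isCrystal_of_isRed' (i := θ) (j := i)
    (fun e => hne (P.root.injective e).symm) (fun e => by
      rw [← root_negIdx] at e
      have hθ := h.isPos
      rw [P.root.injective e, isPos_negIdx] at hθ
      exact hθ hi)
  rw [← wpair_rootWt_eq, ← wpair_rootWt_eq] at hmem
  simp only [Set.mem_insert_iff, Set.mem_singleton_iff, Prod.mk.injEq] at hmem
  omega

/-- The pairings of `ϑ` with the coroots. -/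
lemma IsMaximalShortRoot.two_mul_wpair (h : IsMaximalShortRoot b θ) (i : ι) :
    2 * wpair P (rootWt P θ) i =
      rootSign b i - rootSign b (weylGroup.ofIdx P θ • i) +
        (if i = θ then 2 else 0) - (if i = negIdx P θ then 2 else 0) := by
  have main : ∀ i, b.IsPos i → 2 * wpair P (rootWt P θ) i =
      rootSign b i - rootSign b (weylGroup.ofIdx P θ • i) + (if i = θ then 2 else 0) := by
    intro i hi
    by_cases hθ : i = θ
    · subst hθ
      rw [wpair_rootWt_self, if_pos rfl, ofIdx_smul_self, rootSign_negIdx, rootSign_of_pos hi]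
      norm_num
    · rw [if_neg hθ, rootSign_of_pos hi]
      have h1 := h.wpair_le_one hi hθ
      by_cases hs : b.IsPos (weylGroup.ofIdx P θ • i)
      · have h2 := wpair_nonneg_of_isDominant h.isDominant hi
        have h3 := wpair_nonneg_of_isDominant h.isDominant hs
        rw [← ofIdx_inv, ← wpair_smul_left, smul_rootWt, ofIdx_smul_self, rootWt_negIdx,
          wpair_neg] at h3
        rw [rootSign_of_pos hs]; omega
      · have h2 := wpair_pos_of_inversion h.isPos hi hs
        rw [rootSign_of_not_pos hs]; omega
  by_cases hi : b.IsPos i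
  · rw [main i hi, if_neg (c := i = negIdx P θ), sub_zero]
    rintro rfl
    rw [isPos_negIdx] at hi
    exact hi h.isPos
  · have h1 := main (negIdx P i) ((isPos_negIdx b i).mpr hi)
    rw [wpair_negIdx, smul_negIdx, rootSign_negIdx, rootSign_negIdx] at h1
    have h2 : ¬ i = θ := by rintro rfl; exact hi h.isPos
    have h3 : (negIdx P i = θ) ↔ (i = negIdx P θ) :=
      ⟨fun e => by rw [← e, negIdx_negIdx], fun e => by rw [e, negIdx_negIdx]⟩
    rw [if_neg h2]
    simp only [h3] at h1
    omega

/-- For ϑ the general inequality for reflections becomes an equality: outside ±ϑ the pairing with ϑ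
is exactly half the sign change under s_ϑ, and the correction at ±ϑ gives the last term. -/
lemma IsMaximalShortRoot.invVec_mul (h : IsMaximalShortRoot b θ) (z : P.weylGroup) :
    invVec b (z * weylGroup.ofIdx P θ) - invVec b z =
      twoRhoVec b (rootWt P (z • θ)) - rootSign b (z • θ) • lenVec P θ := by
  funext ν
  have h1 := four_mul_invVec_sub b z θ ν
  have h2 := two_mul_twoRhoVec_smul b z (rootWt P θ) ν
  rw [smul_rootWt] at h2
  have h3 : 4 * twoRhoVec b (rootWt P (z • θ)) ν =
      4 * (invVec b (z * weylGroup.ofIdx P θ) ν - invVec b z ν) +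
        4 * (rootSign b (z • θ) * lenVec P θ ν) := by
    have h4 : 4 * twoRhoVec b (rootWt P (z • θ)) ν =
      ∑ i, rootSign b (z • i) * (2 * wpair P (rootWt P θ) i) * lenVec P i ν := by
      rw [show (4 : ℤ) = 2 * 2 by norm_num, mul_assoc, h2, Finset.mul_sum]
      exact Finset.sum_congr rfl fun i _ => by ring
    rw [h4, h1]
    simp only [h.two_mul_wpair]
    have h5 : ∑ i, rootSign b (z • i) * ((if i = θ then (2 : ℤ) else 0) -
        (if i = negIdx P θ then 2 else 0)) * lenVec P i ν =
        4 * (rootSign b (z • θ) * lenVec P θ ν) := by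
      simp only [mul_sub, sub_mul, Finset.sum_sub_distrib, mul_ite, mul_zero, ite_mul, zero_mul,
        Finset.sum_ite_eq', Finset.mem_univ, if_true, smul_negIdx, rootSign_negIdx, lenVec_negIdx]
      ring
    rw [← h5, ← Finset.sum_add_distrib]
    exact Finset.sum_congr rfl fun i _ => by ring
  simp only [Pi.sub_apply, Pi.smul_apply, smul_eq_mul]
  linarith

end MaximalShortRoot

end Words

/-! ### Regularity and orders at t = 0, and the evaluation of functions at u = w⁻¹. -/

section LaurentValues

variable {ι M N : Type*} [AddCommGroup M] [Module ℝ M] [AddCommGroup N] [Module ℝ N] [Fintype ι]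
  {P : RootPairing ι ℝ M N}

open RootPairing

/-- Constants as rational functions. -/
def constFn (P : RootPairing ι ℝ M N) : FieldQT P →+* RatX (FieldQT P) P :=
  (algebraMap (Laurent (FieldQT P) P) (RatX (FieldQT P) P)).comp
    (algebraMap (FieldQT P) (Laurent (FieldQT P) P))

/-- The monomial `∏ t_ν^{e_ν / 2}`. -/
def tMonomial (P : RootPairing ι ℝ M N) (e : NuR P → ℤ) : RatX (FieldQT P) P :=
  constFn P (∏ ν, tHalf P ν ^ e ν)

lemma tMonomial_zero : tMonomial P 0 = 1 := by simp [tMonomial]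

lemma tMonomial_add (e e' : NuR P → ℤ) :
    tMonomial P (e + e') = tMonomial P e * tMonomial P e' := by
  rw [tMonomial, tMonomial, tMonomial, ← map_mul, ← Finset.prod_mul_distrib]
  congr 1
  exact Finset.prod_congr rfl fun ν _ => zpow_add₀ (tHalf_ne_zero ν) _ _

lemma tMonomial_ne_zero (e : NuR P → ℤ) : tMonomial P e ≠ 0 := by
  intro h
  have h1 := tMonomial_add e (-e)
  rw [add_neg_cancel, tMonomial_zero, h, zero_mul] at h1
  exact one_ne_zero h1

lemma tMonomial_neg (e : NuR P → ℤ) : tMonomial P (-e) = (tMonomial P e)⁻¹ := by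
  refine eq_inv_of_mul_eq_one_left ?_
  rw [← tMonomial_add, neg_add_cancel, tMonomial_zero]

lemma tHalfFn_eq (i : ι) : tHalfFn P (nuOf P i) = tMonomial P (lenVec P i) := by
  rw [tMonomial, Finset.prod_eq_single (nuOf P i)]
  · simp [lenVec]; rfl
  · intro ν _ h; simp [lenVec, h]
  · simp

lemma qRhoFn_eq (b : P.Base) (x : weightLattice P) :
    qRhoFn b x = tMonomial P (twoRhoVec b x) := rfl

lemma X_add (k : Type*) [Field k] (x y : weightLattice P) : X k (x + y) = X k x * X k y := by
  simp [X, ← map_mul, AddMonoidAlgebra.single_mul_single]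

lemma X_zero (k : Type*) [Field k] : X k (0 : weightLattice P) = 1 := by
  rw [X, ← AddMonoidAlgebra.one_def, map_one]

lemma X_ne_zero (k : Type*) [Field k] (x : weightLattice P) : X k x ≠ 0 := by
  intro h
  have h1 := X_add k x (-x)
  rw [add_neg_cancel, X_zero, h, zero_mul] at h1
  exact one_ne_zero h1

lemma X_neg (k : Type*) [Field k] (x : weightLattice P) : X k (-x) = (X k x)⁻¹ := by
  refine eq_inv_of_mul_eq_one_left ?_
  rw [← X_add, neg_add_cancel, X_zero]

lemma incl_single (x : weightLattice P) (c : PolyQT P) :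
    incl P (AddMonoidAlgebra.single x c) =
      constFn P (algebraMap (PolyQT P) (FieldQT P) c) * X (FieldQT P) x := by
  simp only [incl, constFn, X, RingHom.comp_apply, AddMonoidAlgebra.mapRingHom_single, ← map_mul,
    AddMonoidAlgebra.coe_algebraMap, Function.comp_apply, AddMonoidAlgebra.single_mul_single]
  simp

lemma atZero_single (x : weightLattice P) (c : PolyQT P) :
    atZero P (AddMonoidAlgebra.single x c) =
      AddMonoidAlgebra.single x (MvPolynomial.constantCoeff c) := by
  simp [atZero]

lemma incl_injective : Function.Injective (incl P) := by
  have h := AddMonoidAlgebra.map_injective (M := weightLattice P)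
    (algebraMap (PolyQT P) (FieldQT P)).toAddMonoidHom (IsFractionRing.injective _ _)
  exact (IsFractionRing.injective (Laurent (FieldQT P) P) (RatX (FieldQT P) P)).comp h

/-- The function `c` is regular at `t = 0`, with the Laurent polynomial `f₀` as its value, and has
a denominator that becomes `1` at `t = 0`. -/
def HasLaurentValue (c : RatX (FieldQT P) P) (f₀ : Laurent FieldQ P) : Prop :=
  ∃ f g : Laurent (PolyQT P) P, atZero P g = 1 ∧ c * incl P g = incl P f ∧ atZero P f = f₀

namespace HasLaurentValue

lemma hasValueAtZero {c : RatX (FieldQT P) P} {f₀ : Laurent FieldQ P} (h : HasLaurentValue c f₀) :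
    HasValueAtZero c (algebraMap _ (RatX FieldQ P) f₀) := by
  obtain ⟨f, g, hg, hc, hf⟩ := h
  exact ⟨f, g, by rw [hg]; exact one_ne_zero, hc, by rw [hg, hf, map_one, mul_one]⟩

lemma of_incl (f : Laurent (PolyQT P) P) : HasLaurentValue (incl P f) (atZero P f) :=
  ⟨f, 1, map_one _, by simp, rfl⟩

lemma zero : HasLaurentValue (0 : RatX (FieldQT P) P) 0 := by
  simpa using of_incl (0 : Laurent (PolyQT P) P)

lemma one : HasLaurentValue (1 : RatX (FieldQT P) P) 1 := by
  simpa using of_incl (1 : Laurent (PolyQT P) P)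

lemma mul {c c' : RatX (FieldQT P) P} {f₀ f₀' : Laurent FieldQ P} (h : HasLaurentValue c f₀)
    (h' : HasLaurentValue c' f₀') : HasLaurentValue (c * c') (f₀ * f₀') := by
  obtain ⟨f, g, hg, hc, hf⟩ := h
  obtain ⟨f', g', hg', hc', hf'⟩ := h'
  refine ⟨f * f', g * g', by rw [map_mul, hg, hg', mul_one], ?_, by rw [map_mul, hf, hf']⟩
  rw [map_mul, map_mul, ← hc, ← hc']; ring

lemma add {c c' : RatX (FieldQT P) P} {f₀ f₀' : Laurent FieldQ P} (h : HasLaurentValue c f₀)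
    (h' : HasLaurentValue c' f₀') : HasLaurentValue (c + c') (f₀ + f₀') := by
  obtain ⟨f, g, hg, hc, hf⟩ := h
  obtain ⟨f', g', hg', hc', hf'⟩ := h'
  refine ⟨f * g' + f' * g, g * g', by rw [map_mul, hg, hg', mul_one], ?_, ?_⟩
  · rw [map_mul, map_add, map_mul, map_mul, ← hc, ← hc']; ring
  · rw [map_add, map_mul, map_mul, hf, hf', hg, hg', mul_one, mul_one]

lemma neg {c : RatX (FieldQT P) P} {f₀ : Laurent FieldQ P} (h : HasLaurentValue c f₀) :
    HasLaurentValue (-c) (-f₀) := by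
  obtain ⟨f, g, hg, hc, hf⟩ := h
  exact ⟨-f, g, hg, by rw [map_neg, ← hc]; ring, by rw [map_neg, hf]⟩

lemma sub {c c' : RatX (FieldQT P) P} {f₀ f₀' : Laurent FieldQ P} (h : HasLaurentValue c f₀)
    (h' : HasLaurentValue c' f₀') : HasLaurentValue (c - c') (f₀ - f₀') := by
  rw [sub_eq_add_neg, sub_eq_add_neg]; exact h.add h'.neg

lemma ne_zero {c : RatX (FieldQT P) P} (h : HasLaurentValue c 1) : c ≠ 0 := by
  rintro rfl
  obtain ⟨f, g, -, hc, hf⟩ := h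
  rw [zero_mul, eq_comm, map_eq_zero_iff _ incl_injective] at hc
  rw [hc, map_zero] at hf
  exact zero_ne_one hf

/-- The value 1 makes the numerator an admissible denominator, so the two may be exchanged. -/
lemma inv {c : RatX (FieldQT P) P} (h : HasLaurentValue c 1) : HasLaurentValue c⁻¹ 1 := by
  have h0 := h.ne_zero
  obtain ⟨f, g, hg, hc, hf⟩ := h
  exact ⟨g, f, hf, by rw [← hc, inv_mul_cancel_left₀ h0], hg⟩

lemma X (x : weightLattice P) :
    HasLaurentValue (X (FieldQT P) x) (AddMonoidAlgebra.single x 1) := by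
  have := of_incl (AddMonoidAlgebra.single x (1 : PolyQT P))
  rwa [incl_single, atZero_single, map_one, map_one, map_one, one_mul] at this

lemma tMonomial {e : NuR P → ℤ} (he : 0 ≤ e) :
    HasLaurentValue (tMonomial P e) (if e = 0 then 1 else 0) := by
  have h := of_incl (P := P) (AddMonoidAlgebra.single 0 (∏ ν, MvPolynomial.X ν ^ (e ν).toNat))
  have h1 : incl P (AddMonoidAlgebra.single 0 (∏ ν, MvPolynomial.X ν ^ (e ν).toNat)) =
      SpinorRE.tMonomial P e := by
    rw [incl_single, X_zero, mul_one, SpinorRE.tMonomial, map_prod]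
    congr 1
    refine Finset.prod_congr rfl fun ν _ => ?_
    rw [map_pow, ← zpow_natCast, Int.toNat_of_nonneg (he ν)]
    rfl
  have h2 : atZero P (AddMonoidAlgebra.single 0 (∏ ν, MvPolynomial.X ν ^ (e ν).toNat)) =
      if e = 0 then 1 else 0 := by
    rw [atZero_single, map_prod]
    split_ifs with h0
    · subst h0
      simp only [Pi.zero_apply, Int.toNat_zero, pow_zero, map_one, Finset.prod_const_one]
      rfl
    · obtain ⟨ν, hν⟩ := Function.ne_iff.mp h0
      have hp := he ν
      simp only [Pi.zero_apply] at hν hp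
      rw [Finset.prod_eq_zero (Finset.mem_univ ν), AddMonoidAlgebra.single_zero]
      rw [map_pow, MvPolynomial.constantCoeff_X, zero_pow]
      omega
  rwa [h1, h2] at h

end HasLaurentValue

/-- The function `c` is divisible by `∏ t_ν^{e_ν / 2}` at `t = 0`. -/
def HasOrder (e : NuR P → ℤ) (c : RatX (FieldQT P) P) : Prop :=
  ∃ f₀, HasLaurentValue (tMonomial P (-e) * c) f₀

namespace HasOrder

lemma mono {e e' : NuR P → ℤ} {c : RatX (FieldQT P) P} (h : HasOrder e c) (he : e' ≤ e) :
    HasOrder e' c := by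
  obtain ⟨f, hf⟩ := h
  refine ⟨(if e - e' = 0 then 1 else 0) * f, ?_⟩
  have := (HasLaurentValue.tMonomial (sub_nonneg.mpr he)).mul hf
  rwa [← mul_assoc, ← tMonomial_add, show e - e' + -e = -e' by abel] at this

lemma mul {e e' : NuR P → ℤ} {c c' : RatX (FieldQT P) P} (h : HasOrder e c) (h' : HasOrder e' c') :
    HasOrder (e + e') (c * c') := by
  obtain ⟨f, hf⟩ := h
  obtain ⟨f', hf'⟩ := h'
  refine ⟨f * f', ?_⟩
  rw [neg_add, tMonomial_add, mul_mul_mul_comm]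
  exact hf.mul hf'

lemma add {e : NuR P → ℤ} {c c' : RatX (FieldQT P) P} (h : HasOrder e c) (h' : HasOrder e c') :
    HasOrder e (c + c') := by
  obtain ⟨f, hf⟩ := h
  obtain ⟨f', hf'⟩ := h'
  exact ⟨f + f', by rw [mul_add]; exact hf.add hf'⟩

lemma zero (e : NuR P → ℤ) : HasOrder e (0 : RatX (FieldQT P) P) :=
  ⟨0, by rw [mul_zero]; exact HasLaurentValue.zero⟩

lemma tMonomial_mul_X (e : NuR P → ℤ) (x : weightLattice P) :
    HasOrder e (tMonomial P e * SpinorRE.X _ x) :=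
  ⟨_, by rw [← mul_assoc, ← tMonomial_add, neg_add_cancel, tMonomial_zero, one_mul]
         exact HasLaurentValue.X x⟩

end HasOrder

/-- The `w`-component of the spinor of a function, shifted by `Γ_{-ρ_k}`, for `u = w⁻¹`. -/
def evalAt (b : P.Base) (u : P.weylGroup) : RatX (FieldQT P) P →+* RatX (FieldQT P) P :=
  (gamma b : RatX (FieldQT P) P →+* RatX (FieldQT P) P).comp
    (MulSemiringAction.toRingHom P.weylGroup (RatX (FieldQT P) P) u)

lemma evalAt_apply (b : P.Base) (u : P.weylGroup) (g : RatX (FieldQT P) P) :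
    evalAt b u g = gamma b (u • g) := rfl

lemma aeDelta_coeff (b : P.Base) (L : ReflOp P) (v w : P.weylGroup) :
    (aeDelta b L).coeff v w = evalAt b w⁻¹ (L.coeff v) := rfl

lemma evalAt_smul (b : P.Base) (u v : P.weylGroup) (g : RatX (FieldQT P) P) :
    evalAt b u (v • g) = evalAt b (u * v) g := by
  rw [evalAt_apply, evalAt_apply, mul_smul]

lemma smul_algebraMap (u : P.weylGroup) (f : Laurent (FieldQT P) P) :
    u • algebraMap (Laurent (FieldQT P) P) (RatX (FieldQT P) P) f = algebraMap _ _ (u • f) :=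
  IsFractionRing.ringEquivOfRingEquiv_algebraMap _ _

lemma gamma_algebraMap (b : P.Base) (f : Laurent (FieldQT P) P) :
    gamma b (algebraMap (Laurent (FieldQT P) P) (RatX (FieldQT P) P) f) =
      algebraMap _ _ (gammaLaurent b f) :=
  IsFractionRing.ringEquivOfRingEquiv_algebraMap _ _

lemma evalAt_algebraMap_single (b : P.Base) (u : P.weylGroup) (x : weightLattice P)
    (c : FieldQT P) :
    evalAt b u (algebraMap _ _ (AddMonoidAlgebra.single x c)) =
      algebraMap _ _ (AddMonoidAlgebra.single (u • x) (c * (qRho b (u • x))⁻¹)) := by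
  have h : u • (AddMonoidAlgebra.single x c : Laurent (FieldQT P) P) =
      AddMonoidAlgebra.single (u • x) c :=
    AddMonoidAlgebra.domCongr_single _ _ _
  rw [evalAt_apply, smul_algebraMap, gamma_algebraMap, h]
  congr 1
  exact (shiftHom_single b (-1) (u • x) c).trans (by rw [zpow_neg_one])

lemma constFn_apply (c : FieldQT P) :
    constFn P c = algebraMap (Laurent (FieldQT P) P) _ (AddMonoidAlgebra.single 0 c) := rfl

lemma constFn_mul_X (c : FieldQT P) (x : weightLattice P) :
    constFn P c * X _ x = algebraMap (Laurent (FieldQT P) P) _ (AddMonoidAlgebra.single x c) := by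
  rw [constFn_apply, X, ← map_mul, AddMonoidAlgebra.single_mul_single, zero_add, mul_one]

lemma evalAt_X (b : P.Base) (u : P.weylGroup) (x : weightLattice P) :
    evalAt b u (X _ x) = tMonomial P (-twoRhoVec b (u • x)) * X _ (u • x) := by
  rw [X, evalAt_algebraMap_single, one_mul, ← constFn_mul_X, tMonomial_neg, ← qRhoFn_eq, map_inv₀]
  rfl

lemma evalAt_constFn (b : P.Base) (u : P.weylGroup) (c : FieldQT P) :
    evalAt b u (constFn P c) = constFn P c := by
  rw [constFn_apply, evalAt_algebraMap_single, smul_zero, qRho_zero, inv_one, mul_one]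

lemma evalAt_tMonomial (b : P.Base) (u : P.weylGroup) (e : NuR P → ℤ) :
    evalAt b u (tMonomial P e) = tMonomial P e := evalAt_constFn b u _

end LaurentValues

/-! ### Coefficients of T_i and of its inverse. -/

section DemazureLusztig

variable {ι M N : Type*} [AddCommGroup M] [Module ℝ M] [AddCommGroup N] [Module ℝ N] [Fintype ι]
  {P : RootPairing ι ℝ M N} [P.IsCrystallographic]

open RootPairing

/-- The coefficient of `s_i` in `T_i`. -/
def moveCoeff (b : P.Base) (i : b.support) : RatX (FieldQT P) P :=
  tMonomial P (lenVec P i) + (tMonomial P (lenVec P i) - (tMonomial P (lenVec P i))⁻¹) *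
    (X (FieldQT P) (rootWt P (i : ι)) - 1)⁻¹

/-- The coefficient of the identity in `T_i`. -/
def stayCoeff (b : P.Base) (i : b.support) : RatX (FieldQT P) P :=
  -((tMonomial P (lenVec P i) - (tMonomial P (lenVec P i))⁻¹) *
    (X (FieldQT P) (rootWt P (i : ι)) - 1)⁻¹)

/-- The coefficient of the identity in `T_i⁻¹`. -/
def stayCoeffInv (b : P.Base) (i : b.support) : RatX (FieldQT P) P :=
  stayCoeff b i - (tMonomial P (lenVec P i) - (tMonomial P (lenVec P i))⁻¹)

/-- The inverse of `T_i`. -/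
def Tinv (b : P.Base) (i : b.support) : ReflOp P :=
  SkewMonoidAlgebra.single (simpleRefl b i) (moveCoeff b i) +
    SkewMonoidAlgebra.single 1 (stayCoeffInv b i)

lemma T_eq (b : P.Base) (i : b.support) :
    T b i = SkewMonoidAlgebra.single (simpleRefl b i) (moveCoeff b i) +
      SkewMonoidAlgebra.single 1 (stayCoeff b i) := by
  have h1 : (1 : ReflOp P) = SkewMonoidAlgebra.single 1 1 := SkewMonoidAlgebra.one_def
  simp only [T, fn, refl, tHalfFn_eq, moveCoeff, stayCoeff, mul_sub,
    SkewMonoidAlgebra.single_mul_single, one_mul, smul_one, mul_one, SkewMonoidAlgebra.single_add]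
  rw [SkewMonoidAlgebra.ext_iff]
  intro v
  simp only [SkewMonoidAlgebra.coeff_add, SkewMonoidAlgebra.coeff_sub,
    SkewMonoidAlgebra.coeff_single, Finsupp.single_neg, Finsupp.add_apply, Finsupp.sub_apply,
    Finsupp.neg_apply]
  ring

lemma X_ne_one (k : Type*) [Field k] {x : weightLattice P} (hx : x ≠ 0) : X k x ≠ 1 := by
  intro h
  rw [X, ← map_one (algebraMap (Laurent k P) (RatX k P)),
    (IsFractionRing.injective (Laurent k P) (RatX k P)).eq_iff, AddMonoidAlgebra.one_def] at h
  have := congrArg (fun f : Laurent k P => f.coeff x) h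
  simp [AddMonoidAlgebra.coeff_single, hx.symm] at this

lemma rootWt_ne_zero (i : ι) : rootWt P i ≠ 0 := fun h => P.ne_zero i (congrArg Subtype.val h)

lemma smul_X (k : Type*) [Field k] (u : P.weylGroup) (x : weightLattice P) :
    u • X k x = X k (u • x) := by
  have h : u • algebraMap (Laurent k P) (RatX k P) (AddMonoidAlgebra.single x (1 : k)) =
      algebraMap _ _ (u • (AddMonoidAlgebra.single x 1 : Laurent k P)) :=
    IsFractionRing.ringEquivOfRingEquiv_algebraMap _ _
  have h2 : u • (AddMonoidAlgebra.single x 1 : Laurent k P) = AddMonoidAlgebra.single (u • x) 1 :=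
    AddMonoidAlgebra.domCongr_single _ _ _
  rw [X, h, h2, X]

lemma smul_tMonomial (u : P.weylGroup) (e : NuR P → ℤ) : u • tMonomial P e = tMonomial P e := by
  rw [tMonomial, constFn_apply, smul_algebraMap]
  congr 1
  have h2 (c : FieldQT P) : u • (AddMonoidAlgebra.single 0 c : Laurent (FieldQT P) P) =
      AddMonoidAlgebra.single (u • 0) c :=
    AddMonoidAlgebra.domCongr_single _ _ _
  rw [h2, smul_zero]

lemma X_rootWt_sub_one_ne_zero (k : Type*) [Field k] (i : ι) : X k (rootWt P i) - 1 ≠ 0 :=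
  sub_ne_zero.mpr (X_ne_one k (rootWt_ne_zero i))

/-- The reflection replaces X_α by its inverse, and (x⁻¹ - 1)⁻¹ = -1 - (x - 1)⁻¹. With this the
coefficients of s_i in the products of T_i and its inverse cancel. -/
lemma simpleRefl_smul_stayCoeff (b : P.Base) (i : b.support) :
    simpleRefl b i • stayCoeff b i = - stayCoeffInv b i := by
  have h0 := X_rootWt_sub_one_ne_zero (P := P) (FieldQT P) i
  have h1 := X_ne_zero (FieldQT P) (rootWt P (i : ι))
  have h2 := X_rootWt_sub_one_ne_zero (P := P) (FieldQT P) (negIdx P i)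
  rw [rootWt_negIdx, X_neg] at h2
  simp only [stayCoeff, stayCoeffInv, smul_neg, smul_mul', smul_sub, smul_inv'', smul_tMonomial,
    smul_X, smul_one, smul_rootWt, ofIdx_smul_self, rootWt_negIdx, X_neg]
  generalize X (FieldQT P) (rootWt P (i : ι)) = x at *
  have h3 : (x⁻¹ - 1)⁻¹ = - (x * (x - 1)⁻¹) := by
    rw [inv_eq_iff_eq_inv]
    field_simp
    ring
  rw [h3]
  field_simp
  ring

lemma simpleRefl_smul_stayCoeffInv (b : P.Base) (i : b.support) :
    simpleRefl b i • stayCoeffInv b i = - stayCoeff b i := by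
  have h := congrArg (simpleRefl b i • ·) (simpleRefl_smul_stayCoeff b i)
  simp only [smul_smul, ofIdx_mul_self, one_smul, smul_neg] at h
  rw [h, neg_neg]

/-- This is the coefficient of the identity in the product of T_i and its inverse; it expresses the
quadratic Hecke relation. -/
lemma moveCoeff_mul_smul (b : P.Base) (i : b.support) :
    moveCoeff b i * simpleRefl b i • moveCoeff b i + stayCoeff b i * stayCoeffInv b i = 1 := by
  have h0 := X_rootWt_sub_one_ne_zero (P := P) (FieldQT P) i
  have h1 := X_ne_zero (FieldQT P) (rootWt P (i : ι))
  have h2 := X_rootWt_sub_one_ne_zero (P := P) (FieldQT P) (negIdx P i)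
  have ht := tMonomial_ne_zero (lenVec P (i : ι))
  rw [rootWt_negIdx, X_neg] at h2
  simp only [moveCoeff, stayCoeff, stayCoeffInv, smul_add, smul_mul', smul_sub, smul_inv'',
    smul_tMonomial, smul_X, smul_one, smul_rootWt, ofIdx_smul_self, rootWt_negIdx, X_neg]
  generalize X (FieldQT P) (rootWt P (i : ι)) = x at *
  generalize tMonomial P (lenVec P (i : ι)) = t at *
  have h3 : (x⁻¹ - 1)⁻¹ = - (x * (x - 1)⁻¹) := by
    rw [inv_eq_iff_eq_inv]
    field_simp
    ring
  rw [h3]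
  field_simp
  ring

lemma T_mul_Tinv (b : P.Base) (i : b.support) : T b i * Tinv b i = 1 := by
  have h1 := moveCoeff_mul_smul b i
  rw [T_eq, Tinv]
  simp only [mul_add, add_mul, SkewMonoidAlgebra.single_mul_single, ofIdx_mul_self, one_mul,
    mul_one, one_smul, simpleRefl_smul_stayCoeffInv]
  have h0 : SkewMonoidAlgebra.single (simpleRefl b i) (moveCoeff b i * -stayCoeff b i) +
      SkewMonoidAlgebra.single (simpleRefl b i) (stayCoeff b i * moveCoeff b i) = 0 := by
    rw [← SkewMonoidAlgebra.single_add, ← SkewMonoidAlgebra.single_zero (simpleRefl b i)]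
    congr 1; ring
  rw [SkewMonoidAlgebra.one_def, ← h1, SkewMonoidAlgebra.single_add]
  refine sub_eq_zero.mp ?_
  rw [← h0]
  abel

lemma Tinv_mul_T (b : P.Base) (i : b.support) : Tinv b i * T b i = 1 := by
  have h1 := moveCoeff_mul_smul b i
  rw [T_eq, Tinv]
  simp only [mul_add, add_mul, SkewMonoidAlgebra.single_mul_single, ofIdx_mul_self, one_mul,
    mul_one, one_smul, simpleRefl_smul_stayCoeff]
  have h0 : SkewMonoidAlgebra.single (simpleRefl b i) (moveCoeff b i * -stayCoeffInv b i) +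
      SkewMonoidAlgebra.single (simpleRefl b i) (stayCoeffInv b i * moveCoeff b i) = 0 := by
    rw [← SkewMonoidAlgebra.single_add, ← SkewMonoidAlgebra.single_zero (simpleRefl b i)]
    congr 1; ring
  rw [SkewMonoidAlgebra.one_def, ← h1, mul_comm (stayCoeff b i), SkewMonoidAlgebra.single_add]
  refine sub_eq_zero.mp ?_
  rw [← h0]
  abel

/-- The inverse of `Tword` is the product of the inverses in the opposite order. -/
lemma inverse_Tword (b : P.Base) (l : List b.support) :
    Ring.inverse (Tword b l) = (l.reverse.map (Tinv b)).prod := by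
  -- `Ring.inverse` is 0 on non-units, so the factors must be exhibited as units.
  let U (i : b.support) : (ReflOp P)ˣ := ⟨T b i, Tinv b i, T_mul_Tinv b i, Tinv_mul_T b i⟩
  have h1 : ∀ l : List b.support, ((l.map U).prod : ReflOp P) = Tword b l := by
    intro l
    induction l with
    | nil => simp [Tword]
    | cons i l ih => simp only [Tword, List.map_cons, List.prod_cons, Units.val_mul] at ih ⊢; rw [ih]
  have h2 : (((l.map U).prod)⁻¹ : (ReflOp P)ˣ).val = (l.reverse.map (Tinv b)).prod := by
    clear h1
    induction l with
    | nil => simp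
    | cons i l ih =>
      simp only [List.map_cons, List.prod_cons, mul_inv_rev, Units.val_mul, ih, List.reverse_cons,
        List.map_append, List.prod_append, List.map_nil, List.prod_nil, mul_one]
      rfl
  rw [← h1, Ring.inverse_unit, h2]

/-- The recursion behind the inductions along words: the term with s moves the evaluation point of
the remaining operator from u to us, the other term leaves it in place. -/
lemma evalAt_coeff_mul (b : P.Base) (s : P.weylGroup) (hs : s * s = 1)
    (A D : RatX (FieldQT P) P) (L : ReflOp P) (u v : P.weylGroup) :
    evalAt b u (((SkewMonoidAlgebra.single s A + SkewMonoidAlgebra.single 1 D) * L).coeff v) =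
      evalAt b u A * evalAt b (u * s) (L.coeff (s * v)) + evalAt b u D * evalAt b u (L.coeff v) := by
  rw [add_mul, SkewMonoidAlgebra.coeff_add, Finsupp.add_apply, SkewMonoidAlgebra.coeff_single_mul,
    SkewMonoidAlgebra.coeff_single_one_mul, map_add,
    (evalAt b u).map_mul, (evalAt b u).map_mul, evalAt_smul,
    inv_eq_of_mul_eq_one_left hs]

end DemazureLusztig

/-! ### Orders and limits of the coefficients of T_i and T_i⁻¹ at t = 0. -/

section Asymptotics

variable {ι M N : Type*} [AddCommGroup M] [Module ℝ M] [AddCommGroup N] [Module ℝ N] [Fintype ι]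
  {P : RootPairing ι ℝ M N} [P.IsRootSystem] [P.IsCrystallographic]

open RootPairing

lemma sum_twoRhoVec (b : P.Base) (g : ι) :
    ((∑ ν, twoRhoVec b (rootWt P g) ν : ℤ) : ℝ) =
      2 * P.toLinearMap (P.root g) (rhoVee b) := by
  rw [rhoVee, map_smul, smul_eq_mul, mul_inv_cancel_left₀ two_ne_zero, map_sum]
  have : ∑ ν, twoRhoVec b (rootWt P g) ν = ∑ i with b.IsPos i, wpair P (rootWt P g) i := by
    simp only [twoRhoVec, twoRhoPair, ← Finset.filter_filter]
    exact Finset.sum_fiberwise _ _ _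
  rw [this, Int.cast_sum]
  exact Finset.sum_congr rfl fun i _ => wpair_spec P _ i

/-- The inequality holds in each component and the components sum to 2(g, ρ^∨) and 2, so equality of
the sums is equality of the vectors. -/
lemma twoRhoVec_eq_iff {b : P.Base} {g : ι} (hg : b.IsPos g) :
    twoRhoVec b (rootWt P g) - (2 : ℤ) • lenVec P g = 0 ↔
      P.toLinearMap (P.root g) (rhoVee b) = 1 := by
  have h1 := sum_twoRhoVec b g
  have hle : ∀ ν, (2 : ℤ) * lenVec P g ν ≤ twoRhoVec b (rootWt P g) ν :=
    two_mul_lenVec_le_twoRhoVec b hg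
  have h2 : ∑ ν, (2 : ℤ) * lenVec P g ν = 2 := by rw [← Finset.mul_sum, sum_lenVec, mul_one]
  constructor
  · intro h
    have h3 : ∑ ν, twoRhoVec b (rootWt P g) ν = 2 := by
      rw [← h2, sub_eq_zero.mp h]; simp
    rw [h3] at h1
    push_cast at h1
    linarith
  · intro h
    rw [h] at h1
    have h3 : ∑ ν, twoRhoVec b (rootWt P g) ν = 2 := by
      have : ((∑ ν, twoRhoVec b (rootWt P g) ν : ℤ) : ℝ) = ((2 : ℤ) : ℝ) := by rw [h1]; norm_num
      exact_mod_cast this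
    rw [← h2] at h3
    have h4 := (Finset.sum_eq_sum_iff_of_le fun ν _ => hle ν).mp h3.symm
    funext ν
    simp [h4 ν (Finset.mem_univ ν)]

lemma pairing_rhoVee_ne_one_of_not_pos {b : P.Base} {g : ι} (hg : ¬ b.IsPos g) :
    P.toLinearMap (P.root g) (rhoVee b) ≠ 1 := by
  intro h
  have h1 := sum_twoRhoVec b g
  rw [h] at h1
  have h2 : ∑ ν, twoRhoVec b (rootWt P g) ν ≤ 0 := by
    refine Finset.sum_nonpos fun ν _ => ?_
    have h3 := two_mul_lenVec_le_twoRhoVec b ((isPos_negIdx b g).mpr hg) ν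
    rw [rootWt_negIdx, twoRhoVec_neg, Pi.neg_apply] at h3
    have := lenVec_nonneg P (negIdx P g) ν
    linarith
  have h3 : ((∑ ν, twoRhoVec b (rootWt P g) ν : ℤ) : ℝ) ≤ 0 := by exact_mod_cast h2
  linarith

/-- The limit of the coefficient of `s_i` in `T_i`, up to a power of `t`, in terms of the root to
which `α_i` is transformed. -/
def moveValue (b : P.Base) (g : ι) : Laurent FieldQ P :=
  if P.toLinearMap (P.root g) (rhoVee b) = 1 then 1 - AddMonoidAlgebra.single (-rootWt P g) 1 else 1

lemma lenVec_ne_zero (i : ι) : lenVec P i ≠ 0 := by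
  intro h
  have := congrFun h (nuOf P i)
  simp [lenVec] at this

lemma twoRhoVec_root_nonneg {b : P.Base} {g : ι} (hg : b.IsPos g) :
    0 ≤ twoRhoVec b (rootWt P g) := fun ν => by
  have h1 := two_mul_lenVec_le_twoRhoVec b hg ν
  have h2 := lenVec_nonneg P g ν
  simp only [Pi.zero_apply]; linarith

lemma twoRhoVec_root_ne_zero {b : P.Base} {g : ι} (hg : b.IsPos g) :
    twoRhoVec b (rootWt P g) ≠ 0 := fun h => by
  have h1 := two_mul_lenVec_le_twoRhoVec b hg (nuOf P g)
  rw [h] at h1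
  simp [lenVec] at h1

/-- The function `q^{(ρ_k, α)} X_α⁻¹` for a root `α`; it vanishes at `t = 0` for `α > 0`. -/
def smallFn (b : P.Base) (g : ι) : RatX (FieldQT P) P :=
  tMonomial P (twoRhoVec b (rootWt P g)) * X _ (-rootWt P g)

lemma hasLaurentValue_smallFn {b : P.Base} {g : ι} (hg : b.IsPos g) :
    HasLaurentValue (smallFn b g) 0 := by
  have h := (HasLaurentValue.tMonomial (P := P) (twoRhoVec_root_nonneg hg)).mul
    (HasLaurentValue.X (-rootWt P g))
  rwa [if_neg (twoRhoVec_root_ne_zero hg), zero_mul] at h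

lemma hasLaurentValue_inv_one_sub_smallFn {b : P.Base} {g : ι} (hg : b.IsPos g) :
    HasLaurentValue (1 - smallFn b g)⁻¹ 1 := by
  have h := HasLaurentValue.one.sub (hasLaurentValue_smallFn hg)
  rw [sub_zero] at h
  exact h.inv

lemma one_sub_smallFn_ne_zero {b : P.Base} {g : ι} (hg : b.IsPos g) : 1 - smallFn b g ≠ 0 :=
  
  fun h => (hasLaurentValue_inv_one_sub_smallFn hg).ne_zero (by rw [h, inv_zero])

lemma smallFn_ne_zero (b : P.Base) (g : ι) : smallFn b g ≠ 0 :=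
  mul_ne_zero (tMonomial_ne_zero _) (X_ne_zero _ _)

/-- X_α evaluates to the inverse of a small function y, and (y⁻¹ - 1)⁻¹ = y (1 - y)⁻¹ has a
denominator tending to 1. -/
lemma evalAt_inv_X_sub_one_of_pos {b : P.Base} {u : P.weylGroup} {i : ι}
    (h : b.IsPos (u • i)) :
    evalAt b u (X (FieldQT P) (rootWt P i) - 1)⁻¹ =
      smallFn b (u • i) * (1 - smallFn b (u • i))⁻¹ := by
  rw [map_inv₀, map_sub, map_one, evalAt_X, smul_rootWt, tMonomial_neg, ← inv_inv (X _ _), ← X_neg,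
    ← mul_inv, ← smallFn]
  have h1 := smallFn_ne_zero b (u • i)
  have h2 := one_sub_smallFn_ne_zero h
  generalize smallFn b (u • i) = x at *
  rw [inv_eq_iff_eq_inv, mul_inv, inv_inv]
  field_simp

lemma evalAt_inv_X_sub_one_of_not_pos {b : P.Base} {u : P.weylGroup} {i : ι} :
    evalAt b u (X (FieldQT P) (rootWt P i) - 1)⁻¹ =
      - (1 - smallFn b (negIdx P (u • i)))⁻¹ := by
  rw [map_inv₀, map_sub, map_one, evalAt_X, smul_rootWt, smallFn, rootWt_negIdx, neg_neg,
    twoRhoVec_neg, ← inv_neg, neg_sub]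

section Coefficients

variable {b : P.Base} {u : P.weylGroup} {i : b.support}

lemma sq_lenVec (i : ι) : HasLaurentValue (tMonomial P (lenVec P i) * tMonomial P (lenVec P i)) 0 := by
  have h := HasLaurentValue.tMonomial (P := P) (e := lenVec P i) (lenVec_nonneg P i)
  have h2 := h.mul h
  rwa [if_neg (lenVec_ne_zero i), zero_mul] at h2

/-- With y the small function, the product equals (1 - t_i⁻¹ y)(1 - y)⁻¹. The term t_i⁻¹ y survives
at t = 0 only if its t-exponent vanishes, that is for (g, ρ^∨) = 1. -/
lemma evalAt_moveCoeff_of_pos (h : b.IsPos (u • (i : ι))) :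
    HasLaurentValue (tMonomial P (-lenVec P i) * evalAt b u (moveCoeff b i))
      (moveValue b (u • (i : ι))) := by
  set g := u • (i : ι) with hg
  have hd : HasLaurentValue (tMonomial P (twoRhoVec b (rootWt P g) - (2 : ℤ) • lenVec P g) *
      X _ (-rootWt P g)) (1 - moveValue b g) := by
    have h1 := (HasLaurentValue.tMonomial (P := P)
      (e := twoRhoVec b (rootWt P g) - (2 : ℤ) • lenVec P g) (fun ν => by
        have := two_mul_lenVec_le_twoRhoVec b h ν
        simp only [Pi.zero_apply, Pi.sub_apply, Pi.smul_apply, smul_eq_mul]; linarith)).mul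
      (HasLaurentValue.X (-rootWt P g))
    convert h1 using 1
    rw [moveValue]
    simp only [twoRhoVec_eq_iff h]
    split_ifs <;> simp
  have h2 := (HasLaurentValue.one.sub hd).mul (hasLaurentValue_inv_one_sub_smallFn h)
  rw [sub_sub_cancel, mul_one] at h2
  convert h2 using 1
  have h3 : tMonomial P (twoRhoVec b (rootWt P g) - (2 : ℤ) • lenVec P g) * X _ (-rootWt P g) =
      (tMonomial P (lenVec P i))⁻¹ * (tMonomial P (lenVec P i))⁻¹ * smallFn b g := by
    rw [smallFn, ← mul_assoc, ← tMonomial_neg, ← tMonomial_add, ← tMonomial_add, hg, lenVec_smul]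
    congr 2
    rw [two_smul]; abel
  rw [h3, moveCoeff, map_add, map_mul, map_sub, map_inv₀, evalAt_tMonomial,
    evalAt_inv_X_sub_one_of_pos h, tMonomial_neg, ← hg]
  have h4 := one_sub_smallFn_ne_zero h
  have h5 := tMonomial_ne_zero (P := P) (lenVec P i)
  generalize smallFn b g = x at *
  generalize tMonomial P (lenVec P (i : ι)) = t at *
  field_simp
  ring

lemma evalAt_moveCoeff_of_not_pos (h : ¬ b.IsPos (u • (i : ι))) :
    HasLaurentValue (tMonomial P (lenVec P i) * evalAt b u (moveCoeff b i)) 1 := by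
  rw [moveCoeff, map_add, map_mul, map_sub, map_inv₀, evalAt_tMonomial,
    evalAt_inv_X_sub_one_of_not_pos]
  have h1 := hasLaurentValue_inv_one_sub_smallFn ((isPos_negIdx b _).mpr h)
  have h2 := (sq_lenVec (P := P) i).sub (((sq_lenVec (P := P) i).sub HasLaurentValue.one).mul h1)
  convert h2 using 1
  · have h5 := tMonomial_ne_zero (P := P) (lenVec P i)
    generalize (1 - smallFn b (negIdx P (u • (i : ι))))⁻¹ = x at *
    generalize tMonomial P (lenVec P (i : ι)) = t at *
    field_simp
    ring
  · ring

/-- One formula for both signs, since a negative root never pairs to 1 with ρ^∨. -/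
lemma evalAt_moveCoeff :
    HasLaurentValue (tMonomial P (-(rootSign b (u • (i : ι)) • lenVec P i)) *
      evalAt b u (moveCoeff b i)) (moveValue b (u • (i : ι))) := by
  by_cases h : b.IsPos (u • (i : ι))
  · rw [rootSign_of_pos h, one_smul]
    exact evalAt_moveCoeff_of_pos h
  · rw [rootSign_of_not_pos h, neg_smul, one_smul, neg_neg, moveValue,
      if_neg (pairing_rhoVee_ne_one_of_not_pos h)]
    exact evalAt_moveCoeff_of_not_pos h

lemma evalAt_stayCoeff_of_pos (h : b.IsPos (u • (i : ι))) :
    tMonomial P (lenVec P i) * evalAt b u (stayCoeff b i) =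
      (1 - tMonomial P (lenVec P i) * tMonomial P (lenVec P i)) *
        (smallFn b (u • (i : ι)) * (1 - smallFn b (u • (i : ι)))⁻¹) := by
  rw [stayCoeff, map_neg, map_mul, map_sub, map_inv₀, evalAt_tMonomial,
    evalAt_inv_X_sub_one_of_pos h]
  have h5 := tMonomial_ne_zero (P := P) (lenVec P i)
  generalize tMonomial P (lenVec P (i : ι)) = t at *
  field_simp
  ring

lemma evalAt_stayCoeff_of_not_pos :
    tMonomial P (lenVec P i) * evalAt b u (stayCoeff b i) =
      (tMonomial P (lenVec P i) * tMonomial P (lenVec P i) - 1) *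
        (1 - smallFn b (negIdx P (u • (i : ι))))⁻¹ := by
  rw [stayCoeff, map_neg, map_mul, map_sub, map_inv₀, evalAt_tMonomial,
    evalAt_inv_X_sub_one_of_not_pos]
  have h5 := tMonomial_ne_zero (P := P) (lenVec P i)
  generalize tMonomial P (lenVec P (i : ι)) = t at *
  field_simp

lemma evalAt_stayCoeffInv_of_pos (h : b.IsPos (u • (i : ι))) :
    tMonomial P (lenVec P i) * evalAt b u (stayCoeffInv b i) =
      (1 - tMonomial P (lenVec P i) * tMonomial P (lenVec P i)) *
        (1 - smallFn b (u • (i : ι)))⁻¹ := by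
  rw [stayCoeffInv, map_sub, mul_sub, evalAt_stayCoeff_of_pos h, map_sub, map_inv₀,
    evalAt_tMonomial]
  have h4 := one_sub_smallFn_ne_zero h
  have h5 := tMonomial_ne_zero (P := P) (lenVec P i)
  generalize smallFn b (u • (i : ι)) = x at *
  generalize tMonomial P (lenVec P (i : ι)) = t at *
  field_simp
  ring

lemma evalAt_stayCoeffInv_of_not_pos (h : ¬ b.IsPos (u • (i : ι))) :
    tMonomial P (lenVec P i) * evalAt b u (stayCoeffInv b i) =
      (tMonomial P (lenVec P i) * tMonomial P (lenVec P i) - 1) *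
        (smallFn b (negIdx P (u • (i : ι))) * (1 - smallFn b (negIdx P (u • (i : ι))))⁻¹) := by
  rw [stayCoeffInv, map_sub, mul_sub, evalAt_stayCoeff_of_not_pos, map_sub, map_inv₀,
    evalAt_tMonomial]
  have h4 := one_sub_smallFn_ne_zero ((isPos_negIdx b _).mpr h)
  have h5 := tMonomial_ne_zero (P := P) (lenVec P i)
  generalize smallFn b (negIdx P (u • (i : ι))) = x at *
  generalize tMonomial P (lenVec P (i : ι)) = t at *
  field_simp
  ring

lemma hasOrder_moveCoeff :
    HasOrder (rootSign b (u • (i : ι)) • lenVec P i) (evalAt b u (moveCoeff b i)) :=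
  ⟨_, evalAt_moveCoeff⟩

lemma hasOrder_of_eq_mul_smallFn {e : NuR P → ℤ} {c d : RatX (FieldQT P) P} {g : ι}
    {f₀ : Laurent FieldQ P} (hd : HasLaurentValue d f₀) (hg : b.IsPos g)
    (h : tMonomial P e * c = d * (smallFn b g * (1 - smallFn b g)⁻¹)) :
    HasOrder (-e + twoRhoVec b (rootWt P g)) c := by
  have h1 := (hd.mul (HasLaurentValue.X (-rootWt P g))).mul
    (hasLaurentValue_inv_one_sub_smallFn hg)
  refine ⟨f₀ * AddMonoidAlgebra.single (-rootWt P g) 1 * 1, ?_⟩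
  · rw [neg_add, neg_neg, tMonomial_add, mul_right_comm, h]
    convert h1 using 1
    have h2 := tMonomial_ne_zero (P := P) (twoRhoVec b (rootWt P g))
    have h3 : smallFn b g * tMonomial P (-twoRhoVec b (rootWt P g)) = X _ (-rootWt P g) := by
      rw [smallFn, tMonomial_neg, mul_right_comm, mul_inv_cancel₀ h2, one_mul]
    rw [← h3]
    ring

lemma hasLaurentValue_sq_sub_one (i : ι) :
    HasLaurentValue (tMonomial P (lenVec P i) * tMonomial P (lenVec P i) - 1) (-1) := by
  have := (sq_lenVec (P := P) i).sub HasLaurentValue.one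
  rwa [zero_sub] at this

lemma hasLaurentValue_one_sub_sq (i : ι) :
    HasLaurentValue (1 - tMonomial P (lenVec P i) * tMonomial P (lenVec P i)) 1 := by
  have := HasLaurentValue.one.sub (sq_lenVec (P := P) i)
  rwa [sub_zero] at this

lemma hasOrder_stayCoeff_of_pos (h : b.IsPos (u • (i : ι))) :
    HasOrder (-lenVec P i + twoRhoVec b (rootWt P (u • (i : ι)))) (evalAt b u (stayCoeff b i)) :=
  hasOrder_of_eq_mul_smallFn (hasLaurentValue_one_sub_sq _) h (evalAt_stayCoeff_of_pos h)

lemma hasOrder_stayCoeff_of_not_pos (h : ¬ b.IsPos (u • (i : ι))) :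
    HasOrder (-lenVec P i) (evalAt b u (stayCoeff b i)) := by
  refine ⟨-1 * 1, ?_⟩
  · rw [neg_neg, evalAt_stayCoeff_of_not_pos]
    exact (hasLaurentValue_sq_sub_one _).mul
      (hasLaurentValue_inv_one_sub_smallFn ((isPos_negIdx b _).mpr h))

lemma hasOrder_stayCoeffInv_of_pos (h : b.IsPos (u • (i : ι))) :
    HasOrder (-lenVec P i) (evalAt b u (stayCoeffInv b i)) := by
  refine ⟨1 * 1, ?_⟩
  · rw [neg_neg, evalAt_stayCoeffInv_of_pos h]
    exact (hasLaurentValue_one_sub_sq _).mul (hasLaurentValue_inv_one_sub_smallFn h)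

lemma hasOrder_stayCoeffInv_of_not_pos (h : ¬ b.IsPos (u • (i : ι))) :
    HasOrder (-lenVec P i - twoRhoVec b (rootWt P (u • (i : ι))))
      (evalAt b u (stayCoeffInv b i)) := by
  have := hasOrder_of_eq_mul_smallFn (hasLaurentValue_sq_sub_one _) ((isPos_negIdx b _).mpr h)
    (evalAt_stayCoeffInv_of_not_pos h)
  rwa [rootWt_negIdx, twoRhoVec_neg, ← sub_eq_add_neg] at this

end Coefficients

/-- The coefficients of the operator `L` at `w = u⁻¹` are divisible by `t^{G(u) / 2}`. -/
def OpOrder (b : P.Base) (G : P.weylGroup → NuR P → ℤ) (L : ReflOp P) : Prop :=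
  ∀ u v, HasOrder (G u) (evalAt b u (L.coeff v))

/-- An order estimate for a product is reduced to inequalities between integer vectors: one for the
reflection term, and one for the identity term in each sign case. -/
lemma OpOrder.T_mul {b : P.Base} {G G' : P.weylGroup → NuR P → ℤ} {L : ReflOp P}
    (hL : OpOrder b G L) (j : b.support)
    (hmove : ∀ u, G' u ≤ rootSign b (u • (j : ι)) • lenVec P j + G (u * simpleRefl b j))
    (hpos : ∀ u, b.IsPos (u • (j : ι)) →
      G' u ≤ -lenVec P j + twoRhoVec b (rootWt P (u • (j : ι))) + G u)
    (hneg : ∀ u, ¬ b.IsPos (u • (j : ι)) → G' u ≤ -lenVec P j + G u) :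
    OpOrder b G' (T b j * L) := by
  intro u v
  rw [T_eq, evalAt_coeff_mul _ _ (ofIdx_mul_self P j)]
  refine ((hasOrder_moveCoeff.mul (hL _ _)).mono (hmove u)).add ?_
  by_cases h : b.IsPos (u • (j : ι))
  · exact ((hasOrder_stayCoeff_of_pos h).mul (hL u v)).mono (hpos u h)
  · exact ((hasOrder_stayCoeff_of_not_pos h).mul (hL u v)).mono (hneg u h)

lemma OpOrder.Tinv_mul {b : P.Base} {G G' : P.weylGroup → NuR P → ℤ} {L : ReflOp P}
    (hL : OpOrder b G L) (j : b.support)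
    (hmove : ∀ u, G' u ≤ rootSign b (u • (j : ι)) • lenVec P j + G (u * simpleRefl b j))
    (hpos : ∀ u, b.IsPos (u • (j : ι)) → G' u ≤ -lenVec P j + G u)
    (hneg : ∀ u, ¬ b.IsPos (u • (j : ι)) →
      G' u ≤ -lenVec P j - twoRhoVec b (rootWt P (u • (j : ι))) + G u) :
    OpOrder b G' (Tinv b j * L) := by
  intro u v
  rw [Tinv, evalAt_coeff_mul _ _ (ofIdx_mul_self P j)]
  refine ((hasOrder_moveCoeff.mul (hL _ _)).mono (hmove u)).add ?_
  by_cases h : b.IsPos (u • (j : ι))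
  · exact ((hasOrder_stayCoeffInv_of_pos h).mul (hL u v)).mono (hpos u h)
  · exact ((hasOrder_stayCoeffInv_of_not_pos h).mul (hL u v)).mono (hneg u h)

end Asymptotics

/-! ### Orders of the coefficients of T_w and its leading coefficient. -/

section Words

variable {ι M N : Type*} [AddCommGroup M] [Module ℝ M] [AddCommGroup N] [Module ℝ N] [Fintype ι]
  {P : RootPairing ι ℝ M N} [P.IsRootSystem] [P.IsCrystallographic]

open RootPairing

lemma mul_ofIdx_mul (u v : P.weylGroup) (j : ι) :
    u * (weylGroup.ofIdx P j * v) = weylGroup.ofIdx P (u • j) * (u * v) := by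
  rw [← mul_assoc, mul_ofIdx, mul_assoc]

lemma ofIdx_mul_ofIdx_mul (z : P.weylGroup) (g : ι) :
    weylGroup.ofIdx P g * (weylGroup.ofIdx P g * z) = z := by
  rw [← mul_assoc, ofIdx_mul_self, one_mul]

section InversionBounds

variable (b : P.Base) {u v : P.weylGroup} {j : ι} (ν : NuR P)

/-- As u s_j v = s_γ u v with γ = u(α_j), left reflections compare the two inversion vectors. This
bound and the next one serve the identity terms of T_j; the two after them serve those of T_j⁻¹. -/
lemma invVec_move_le_of_pos (h : b.IsPos (u • j)) :
    invVec b (u * (weylGroup.ofIdx P j * v)) ν + lenVec P j ν - twoRhoVec b (rootWt P (u • j)) ν ≤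
      invVec b (u * v) ν := by
  have := lenVec_sub_le_invVec_sub_left b (weylGroup.ofIdx P (u • j) * (u * v)) h ν
  rw [ofIdx_mul_ofIdx_mul, lenVec_smul, ← mul_ofIdx_mul] at this
  linarith

lemma invVec_move_le_of_not_pos (h : ¬ b.IsPos (u • j)) (hv : b.IsPos (v⁻¹ • j)) :
    invVec b (u * (weylGroup.ofIdx P j * v)) ν + lenVec P j ν ≤ invVec b (u * v) ν := by
  have := le_invVec_sub_of_pos_left b (weylGroup.ofIdx P (u • j) * (u * v))
    ((isPos_negIdx b _).mpr h) (by
      rw [mul_inv_rev, mul_inv_rev, ofIdx_inv, mul_smul, smul_negIdx, ofIdx_smul_self,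
        negIdx_negIdx, mul_smul, inv_smul_smul]
      exact hv) ν
  rw [ofIdx_negIdx, ofIdx_mul_ofIdx_mul, lenVec_negIdx, lenVec_smul, ← mul_ofIdx_mul] at this
  linarith

lemma le_invVec_move_of_pos (h : b.IsPos (u • j)) (hv : b.IsPos (v⁻¹ • j)) :
    invVec b (u * v) ν + lenVec P j ν ≤ invVec b (u * (weylGroup.ofIdx P j * v)) ν := by
  have := le_invVec_sub_of_pos_left b (u * v) h (by
    rw [mul_inv_rev, mul_smul, inv_smul_smul]
    exact hv) ν
  rw [lenVec_smul, ← mul_ofIdx_mul] at this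
  linarith

lemma le_invVec_move_of_not_pos (h : ¬ b.IsPos (u • j)) :
    invVec b (u * v) ν + lenVec P j ν + twoRhoVec b (rootWt P (u • j)) ν ≤
      invVec b (u * (weylGroup.ofIdx P j * v)) ν := by
  have := lenVec_sub_le_invVec_sub_left b (u * v) ((isPos_negIdx b _).mpr h) ν
  rw [ofIdx_negIdx, lenVec_negIdx, lenVec_smul, ← mul_ofIdx_mul, rootWt_negIdx, twoRhoVec_neg,
    Pi.neg_apply] at this
  linarith

end InversionBounds

lemma IsReducedWord.tail {b : P.Base} {j : b.support} {l : List b.support} {w : P.weylGroup}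
    (h : IsReducedWord b (j :: l) w) : IsReducedWord b l (wordProd b l) := by
  refine ⟨rfl, fun l' hl' => ?_⟩
  have := h.2 (j :: l') (by rw [← h.1, wordProd_cons, wordProd_cons, hl'])
  simpa using this

lemma coeff_mul_of_single_add_single (s : P.weylGroup) (hs : s * s = 1)
    (A D : RatX (FieldQT P) P) (L : ReflOp P) (v : P.weylGroup) :
    ((SkewMonoidAlgebra.single s A + SkewMonoidAlgebra.single 1 D) * L).coeff v =
      A * s • (L.coeff (s * v)) + D * L.coeff v := by
  rw [add_mul, SkewMonoidAlgebra.coeff_add, Finsupp.add_apply, SkewMonoidAlgebra.coeff_single_mul,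
    SkewMonoidAlgebra.coeff_single_one_mul, inv_eq_of_mul_eq_one_left hs]

lemma coeff_one (v : P.weylGroup) : (1 : ReflOp P).coeff v = if v = 1 then 1 else 0 := by
  rw [SkewMonoidAlgebra.one_def, SkewMonoidAlgebra.coeff_single, Finsupp.single_apply]
  simp only [eq_comm]

lemma Tword_nil (b : P.Base) : Tword b [] = 1 := rfl

lemma Tword_cons (b : P.Base) (j : b.support) (l : List b.support) :
    Tword b (j :: l) = T b j * Tword b l := by simp [Tword]

/-- The operator `T_w` is supported on the products of subwords. -/
lemma exists_sublist_of_coeff_Tword_ne_zero {b : P.Base} {l : List b.support} {v : P.weylGroup}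
    (h : (Tword b l).coeff v ≠ 0) : ∃ l' : List b.support, l'.Sublist l ∧ wordProd b l' = v := by
  induction l generalizing v with
  | nil =>
    rw [Tword_nil, coeff_one] at h
    refine ⟨[], List.Sublist.slnil, ?_⟩
    by_contra hv
    exact h (if_neg fun hv' => hv (by rw [hv']; rfl))
  | cons j l ih =>
    rw [Tword_cons, T_eq, coeff_mul_of_single_add_single _ (ofIdx_mul_self P j)] at h
    by_cases h1 : (Tword b l).coeff (simpleRefl b j * v) = 0
    · by_cases h2 : (Tword b l).coeff v = 0
      · rw [h1, h2, smul_zero, mul_zero, mul_zero, add_zero] at h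
        exact absurd rfl h
      · obtain ⟨l', hl', hv⟩ := ih h2
        exact ⟨l', hl'.cons j, hv⟩
    · obtain ⟨l', hl', hv⟩ := ih h1
      exact ⟨j :: l', hl'.cons_cons j, by rw [wordProd_cons, hv, ofIdx_mul_ofIdx_mul]⟩

variable [P.IsReduced]

/-- The reflection term of the first letter has exactly the order required. Its identity term is
controlled by the bounds for reflections, where reducedness gives the positivity needed when u(α_j)
< 0. -/
lemma opOrder_Tword {b : P.Base} {l : List b.support} {w : P.weylGroup}
    (h : IsReducedWord b l w) :
    OpOrder b (fun u => invVec b (u * w) - invVec b u) (Tword b l) := by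
  induction l generalizing w with
  | nil =>
    intro u v
    simp only [← h.1, wordProd_nil, mul_one, sub_self, Tword_nil, coeff_one]
    refine ⟨if v = 1 then 1 else 0, ?_⟩
    rw [neg_zero, tMonomial_zero, one_mul]
    split_ifs
    · rw [map_one]; exact HasLaurentValue.one
    · rw [map_zero]; exact HasLaurentValue.zero
  | cons j l ih =>
    have hpos := IsReducedWord.isPos_suffix (l₁ := []) h
    rw [Tword_cons, ← h.1, wordProd_cons]
    refine (ih h.tail).T_mul j (fun u => ?_) (fun u hu => ?_) (fun u hu => ?_)
    · rw [invVec_mul_simple b u j, ← mul_assoc]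
      exact le_of_eq (by abel)
    · intro ν
      have := invVec_move_le_of_pos b (v := wordProd b l) ν hu
      simp only [Pi.add_apply, Pi.sub_apply, Pi.neg_apply]
      linarith
    · intro ν
      have := invVec_move_le_of_not_pos b ν hu hpos
      simp only [Pi.add_apply, Pi.sub_apply, Pi.neg_apply]
      linarith

/-- Only the choice of the reflection in every letter produces w, so the coefficient is a product of
coefficients of the s_i, evaluated at the roots u(α) for α an inversion of w⁻¹. -/
lemma hasLaurentValue_coeff_Tword {b : P.Base} {l : List b.support} {w : P.weylGroup}
    (h : IsReducedWord b l w) (u : P.weylGroup) :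
    HasLaurentValue
      (tMonomial P (-(invVec b (u * w) - invVec b u)) * evalAt b u ((Tword b l).coeff w))
      (∏ i ∈ lambdaSet b w⁻¹, moveValue b (u • i)) := by
  induction l generalizing w u with
  | nil =>
    have h1 : lambdaSet b (1 : P.weylGroup) = ∅ := by
      simp only [lambdaSet, one_smul, and_not_self, Finset.filter_false]
    rw [← h.1, wordProd_nil, mul_one, sub_self, Tword_nil, coeff_one, if_pos rfl, neg_zero,
      tMonomial_zero, map_one, mul_one, inv_one, h1, Finset.prod_empty]
    exact HasLaurentValue.one
  | cons j l ih =>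
    have hpos := IsReducedWord.isPos_suffix (l₁ := []) h
    -- A subword of the tail is too short to represent w.
    have hzero : (Tword b l).coeff w = 0 := by
      by_contra hne
      obtain ⟨l', hl', hw⟩ := exists_sublist_of_coeff_Tword_ne_zero hne
      have h1 := h.2 l' hw
      have h2 := hl'.length_le
      rw [List.length_cons] at h1
      omega
    rw [Tword_cons, T_eq, evalAt_coeff_mul _ _ (ofIdx_mul_self P j), hzero, map_zero, mul_zero,
      add_zero]
    rw [← h.1, wordProd_cons, prod_lambdaSet_inv_cons _ hpos, ofIdx_mul_ofIdx_mul]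
    have h1 := (evalAt_moveCoeff (b := b) (u := u) (i := j)).mul (ih h.tail (u * simpleRefl b j))
    simp only [mul_smul] at h1
    convert h1 using 1
    rw [mul_mul_mul_comm, ← tMonomial_add, invVec_mul_simple b u j, mul_assoc u]
    congr 2
    abel

end Words

/-! ### The limits of T_i, X_b and X_ω T_{u⁻¹}. -/

section Limits

variable {ι M N : Type*} [AddCommGroup M] [Module ℝ M] [AddCommGroup N] [Module ℝ N] [Fintype ι]
  {P : RootPairing ι ℝ M N} [P.IsRootSystem] [P.IsCrystallographic]

open RootPairing

lemma fn_mul_coeff (g : RatX (FieldQT P) P) (L : ReflOp P) (v : P.weylGroup) :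
    (fn g * L).coeff v = g * L.coeff v :=
  SkewMonoidAlgebra.coeff_single_one_mul _ _ _

lemma fn_coeff (g : RatX (FieldQT P) P) (v : P.weylGroup) :
    (fn g).coeff v = if v = 1 then g else 0 := by
  rw [fn, SkewMonoidAlgebra.coeff_single, Finsupp.single_apply]
  simp only [eq_comm]

lemma spinMul_mul_delta {W F : Type*} [Group W] [CommRing F] (f : Spin W F) (v : W) :
    spinMul f * delta F v = SkewMonoidAlgebra.single v f := by
  rw [spinMul, delta, SkewMonoidAlgebra.single_mul_single, one_mul, one_smul, mul_one]

lemma single_coeff_apply {W F : Type*} [Group W] [CommRing F] (f : Spin W F) (v v' w : W) :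
    (SkewMonoidAlgebra.single v f : SpinOp W F).coeff v' w = if v' = v then f w else 0 := by
  rw [SkewMonoidAlgebra.coeff_single, Finsupp.single_apply]
  by_cases h : v = v'
  · rw [if_pos h, if_pos h.symm]
  · rw [if_neg h, if_neg (Ne.symm h)]; rfl

lemma spin_sum_apply {W F κ : Type*} [CommRing F] (s : Finset κ) (f : κ → Spin W F) (w : W) :
    (∑ i ∈ s, f i) w = ∑ i ∈ s, f i w :=
  Finset.sum_apply w s f

lemma sum_zeta_apply {W F : Type*} [CommRing F] (s : Finset W) (f : W → F) (w : W) :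
    (∑ v ∈ s, zeta v (f v)) w = if w ∈ s then f w else 0 := by
  rw [spin_sum_apply]
  simp only [zeta]
  rw [Finset.sum_ite_eq]

lemma spinOp_add_coeff_apply {W F : Type*} [Group W] [CommRing F] (A B : SpinOp W F) (v w : W) :
    (A + B).coeff v w = A.coeff v w + B.coeff v w := by
  rw [SkewMonoidAlgebra.coeff_add, Finsupp.add_apply]; rfl

lemma sum_spinOp_coeff_apply {W F κ : Type*} [Group W] [CommRing F] (s : Finset κ)
    (f : κ → SpinOp W F) (v w : W) :
    (∑ i ∈ s, f i).coeff v w = ∑ i ∈ s, (f i).coeff v w := by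
  induction s using Finset.induction_on with
  | empty => simp only [Finset.sum_empty]; rfl
  | insert i s hi ih =>
    rw [Finset.sum_insert hi, Finset.sum_insert hi, ← ih, spinOp_add_coeff_apply]

lemma hasRE_of_hasLaurentValue {b : P.Base} {L : ReflOp P}
    {L₀ : SpinOp P.weylGroup (RatX FieldQ P)} (c : P.weylGroup → P.weylGroup → Laurent FieldQ P)
    (h : ∀ v w, HasLaurentValue (evalAt b w⁻¹ (L.coeff v)) (c v w))
    (hL : ∀ v w, L₀.coeff v w = algebraMap _ _ (c v w)) : HasRE b L L₀ := fun v w => by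
  rw [aeDelta_coeff, hL]
  exact (h v w).hasValueAtZero

/-- If all coefficients are regular, then the limit exists. -/
lemma OpOrder.exists_hasRE {b : P.Base} {L : ReflOp P} (h : OpOrder b 0 L) :
    ∃ L₀, HasRE b L L₀ := by
  have h1 : ∀ v w, ∃ c, HasLaurentValue (evalAt b w⁻¹ (L.coeff v)) c := fun v w => by
    obtain ⟨c, hc⟩ := h w⁻¹ v
    rw [Pi.zero_apply, neg_zero, tMonomial_zero, one_mul] at hc
    exact ⟨c, hc⟩
  choose c hc using h1
  refine ⟨⟨Finsupp.equivFunOnFinite.symm fun v w => algebraMap _ _ (c v w)⟩,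
    hasRE_of_hasLaurentValue c hc fun v w => rfl⟩

lemma hasLaurentValue_ite {p : Prop} [Decidable p] {c : RatX (FieldQT P) P} {f : Laurent FieldQ P}
    (h : p → HasLaurentValue c f) : HasLaurentValue (if p then c else 0) (if p then f else 0) := by
  split_ifs with hp
  · exact h hp
  · exact HasLaurentValue.zero

/-- The limit of `t_i^{1/2} T_i`. -/
theorem hasRE_T (b : P.Base) (i : b.support) :
    HasRE b (fn (tHalfFn P (nuOf P i)) * T b i)
      (∑ w : P.weylGroup with ¬ b.IsPos (w⁻¹ • (i : ι)),
        spinMul (zeta w 1) * (delta _ (simpleRefl b i) - 1)) := by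
  set e : P.weylGroup → Laurent FieldQ P := fun w => if b.IsPos (w⁻¹ • (i : ι)) then 0 else 1
  refine hasRE_of_hasLaurentValue (fun v w => (if v = simpleRefl b i then e w else 0) -
    (if v = 1 then e w else 0)) (fun v w => ?_) fun v w => ?_
  · have hA : HasLaurentValue (tMonomial P (lenVec P i) * evalAt b w⁻¹ (moveCoeff b i)) (e w) := by
      simp only [e]
      split_ifs with h
      · have h1 := (sq_lenVec (P := P) i).mul (evalAt_moveCoeff_of_pos h)
        rw [zero_mul, ← mul_assoc, mul_assoc (tMonomial P _), ← tMonomial_add, add_neg_cancel,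
          tMonomial_zero, mul_one] at h1
        exact h1
      · exact evalAt_moveCoeff_of_not_pos h
    have hD : HasLaurentValue (tMonomial P (lenVec P i) * evalAt b w⁻¹ (stayCoeff b i))
        (-e w) := by
      simp only [e]
      split_ifs with h
      · rw [evalAt_stayCoeff_of_pos h]
        have h1 := (hasLaurentValue_one_sub_sq (P := P) i).mul
          ((hasLaurentValue_smallFn h).mul (hasLaurentValue_inv_one_sub_smallFn h))
        rwa [zero_mul, mul_zero, ← neg_zero] at h1
      · rw [evalAt_stayCoeff_of_not_pos]
        have h1 := (hasLaurentValue_sq_sub_one (P := P) i).mul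
          (hasLaurentValue_inv_one_sub_smallFn ((isPos_negIdx b _).mpr h))
        rwa [mul_one] at h1
    have h := (hasLaurentValue_ite (p := v = simpleRefl b i) fun _ => hA).add
      (hasLaurentValue_ite (p := v = 1) fun _ => hD)
    rw [fn_mul_coeff, T_eq, tHalfFn_eq, (evalAt b w⁻¹).map_mul, evalAt_tMonomial,
      SkewMonoidAlgebra.coeff_add, Finsupp.add_apply, SkewMonoidAlgebra.coeff_single,
      SkewMonoidAlgebra.coeff_single, Finsupp.single_apply, Finsupp.single_apply, map_add]
    convert h using 1
    · rw [mul_add]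
      simp only [eq_comm (b := v)]
      congr 1
      · split_ifs <;> simp
      · split_ifs <;> simp
    · split_ifs <;> ring
  · rw [← Finset.sum_mul, mul_sub, mul_one]
    have h1 : (∑ w : P.weylGroup with ¬ b.IsPos (w⁻¹ • (i : ι)), spinMul (zeta w 1) :
        SpinOp P.weylGroup (RatX FieldQ P)) =
        spinMul (∑ w : P.weylGroup with ¬ b.IsPos (w⁻¹ • (i : ι)), zeta w 1) := by
      simp only [spinMul]
      exact (map_sum (SkewMonoidAlgebra.singleAddHom (k := Spin P.weylGroup (RatX FieldQ P))
        (1 : P.weylGroup)) _ _).symm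
    have h2 : ∀ f : Spin P.weylGroup (RatX FieldQ P), (spinMul f * delta _ (simpleRefl b i) -
        spinMul f).coeff v w = (if v = simpleRefl b i then f w else 0) -
          (if v = 1 then f w else 0) := fun f => by
      have h3 := spinOp_add_coeff_apply (SkewMonoidAlgebra.single (simpleRefl b i) f -
        SkewMonoidAlgebra.single 1 f) (SkewMonoidAlgebra.single 1 f) v w
      rw [sub_add_cancel, single_coeff_apply, single_coeff_apply] at h3
      rw [spinMul_mul_delta, spinMul, eq_sub_iff_add_eq]
      convert h3.symm
    rw [h1, h2, sum_zeta_apply]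
    simp only [Finset.mem_filter, Finset.mem_univ, true_and, e]
    split_ifs <;> simp

variable [P.IsReduced]

/-- The limit of `q^{(b_+, ρ_k)} X_b`. -/
theorem hasRE_X {b : P.Base} {x xp : weightLattice P} (hx : xp ∈ MulAction.orbit P.weylGroup x)
    (hxp : IsDominant b xp) :
    HasRE b (fn (qRhoFn b xp * X _ x))
      (spinMul (∑ w : P.weylGroup with w⁻¹ • x = xp, zeta w (X FieldQ xp))) := by
  obtain ⟨g, rfl⟩ := hx
  change IsDominant b (g • x) at hxp
  refine hasRE_of_hasLaurentValue (fun v w => if v = 1 then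
    (if w⁻¹ • x = g • x then AddMonoidAlgebra.single (g • x) 1 else 0) else 0)
    (fun v w => ?_) fun v w => ?_
  · rw [fn_coeff, apply_ite (evalAt b w⁻¹), map_zero]
    refine hasLaurentValue_ite (P := P) fun _ => ?_
    rw [(evalAt b w⁻¹).map_mul, qRhoFn_eq, evalAt_tMonomial, evalAt_X, ← mul_assoc, ← tMonomial_add]
    have hu : w⁻¹ • x = (w⁻¹ * g⁻¹) • (g • x) := by rw [mul_smul, inv_smul_smul]
    have hle := twoRhoVec_smul_le hxp (w⁻¹ * g⁻¹)
    rw [← hu] at hle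
    have h1 := (HasLaurentValue.tMonomial (P := P) (sub_nonneg.mpr hle)).mul
      (HasLaurentValue.X (w⁻¹ • x))
    rw [sub_eq_add_neg] at h1
    convert h1 using 1
    by_cases h : w⁻¹ • x = g • x
    · rw [if_pos h, h, add_neg_cancel, if_pos rfl, one_mul]
    -- For a weight of the orbit other than the dominant one, some exponent of t is strictly
    -- positive.
    · rw [if_neg h, if_neg, zero_mul]
      intro h0
      rw [hu] at h h0
      exact h (smul_eq_self_of_twoRhoVec_eq hxp _ (add_neg_eq_zero.mp h0).symm)
  · rw [spinMul, single_coeff_apply, sum_zeta_apply]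
    simp only [Finset.mem_filter, Finset.mem_univ, true_and]
    split_ifs <;> simp [X]

lemma IsFundamentalWeight.isDominant {b : P.Base} {r : b.support} {x : weightLattice P}
    (h : IsFundamentalWeight b r x) : IsDominant b x := fun j => by
  rw [h j]; split_ifs <;> norm_num

/-- For minuscule x the pairings with positive coroots are 0 or 1, and 1 exactly on the inversions
of u_x. So they are half the sign changes under u_x, and summing against the signs of u(α) gives the
identity. -/
lemma twoRhoVec_smul_of_isMinuscule {b : P.Base} {x : weightLattice P} (hx : IsDominant b x)
    (hm : IsMinuscule b x) (u : P.weylGroup) :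
    invVec b (u * (uElt b x)⁻¹) - invVec b u = twoRhoVec b (u • x) := by
  have hpos : ∀ i, b.IsPos i → rootSign b i - rootSign b (uElt b x • i) = 2 * wpair P x i := by
    intro i hi
    have h1 := mem_lambdaSet_uElt hx i
    simp only [lambdaSet, Finset.mem_filter, Finset.mem_univ, true_and, hi] at h1
    have h2 := wpair_nonneg_of_isDominant hx hi
    have h3 := hm i hi
    rw [rootSign_of_pos hi]
    by_cases h : b.IsPos (uElt b x • i)
    · rw [rootSign_of_pos h]
      have := mt h1.mpr (not_not.mpr h)
      omega
    · rw [rootSign_of_not_pos h]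
      have := h1.mp h
      omega
  have hall : ∀ i, rootSign b i - rootSign b (uElt b x • i) = 2 * wpair P x i := by
    intro i
    by_cases hi : b.IsPos i
    · exact hpos i hi
    · have := hpos (negIdx P i) ((isPos_negIdx b i).mpr hi)
      rw [smul_negIdx, rootSign_negIdx, rootSign_negIdx, wpair_negIdx] at this
      omega
  funext ν
  have h1 := invVec_eq_sum b (u * (uElt b x)⁻¹) ν
  have h2 := invVec_eq_sum b u ν
  have h3 := two_mul_twoRhoVec_smul b u x ν
  rw [← sum_smul_index (uElt b x)] at h1
  simp only [mul_smul, inv_smul_smul, lenVec_smul] at h1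
  have h4 : 4 * invVec b (u * (uElt b x)⁻¹) ν - 4 * invVec b u ν =
      2 * (2 * twoRhoVec b (u • x) ν) := by
    rw [h1, h2, h3, ← Finset.sum_sub_distrib, Finset.mul_sum]
    refine Finset.sum_congr rfl fun i _ => ?_
    linear_combination (rootSign b (u • i) * lenVec P i ν) * hall i
  rw [Pi.sub_apply]
  omega

/-- The limit of `X_ω T_{u⁻¹}` for a minuscule weight `ω`. -/
theorem hasRE_X_mul_Tword {b : P.Base} {x : weightLattice P} (hx : IsDominant b x)
    (hm : IsMinuscule b x) {l : List b.support} (hl : IsReducedWord b l (uElt b x)⁻¹) :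
    ∃ f : P.weylGroup → P.weylGroup → Laurent FieldQ P,
      HasRE b (fn (X _ x) * Tword b l)
        (spinMul (∑ w : P.weylGroup, zeta w (X FieldQ (w⁻¹ • x) *
            ∏ α ∈ lambdaSet b (uElt b x) with P.toLinearMap (P.root (w⁻¹ • α)) (rhoVee b) = 1,
              (1 - (X FieldQ (rootWt P (w⁻¹ • α)))⁻¹))) * delta _ (uElt b x)⁻¹ +
          ∑ v : P.weylGroup with BruhatLT b v (uElt b x)⁻¹,
            spinMul (∑ w : P.weylGroup, zeta w (algebraMap _ _ (f v w))) * delta _ v) := by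
  have horder : ∀ u v, ∃ f₀, HasLaurentValue
      (tMonomial P (-twoRhoVec b (u • x)) * evalAt b u ((Tword b l).coeff v)) f₀ := fun u v => by
    have := opOrder_Tword hl u v
    simp only [twoRhoVec_smul_of_isMinuscule hx hm] at this
    exact this
  choose f₀ hf₀ using horder
  have hmul : ∀ v w, evalAt b w⁻¹ ((fn (X _ x) * Tword b l).coeff v) = X _ (w⁻¹ • x) *
      (tMonomial P (-twoRhoVec b (w⁻¹ • x)) * evalAt b w⁻¹ ((Tword b l).coeff v)) := fun v w => by
    rw [fn_mul_coeff, (evalAt b w⁻¹).map_mul, evalAt_X]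
    ring
  refine ⟨fun v w => AddMonoidAlgebra.single (w⁻¹ • x) 1 * f₀ w⁻¹ v, ?_⟩
  refine hasRE_of_hasLaurentValue (fun v w => if v = (uElt b x)⁻¹ then
      AddMonoidAlgebra.single (w⁻¹ • x) 1 * ∏ α ∈ lambdaSet b (uElt b x), moveValue b (w⁻¹ • α)
    else if BruhatLT b v (uElt b x)⁻¹ then AddMonoidAlgebra.single (w⁻¹ • x) 1 * f₀ w⁻¹ v else 0)
    (fun v w => ?_) fun v w => ?_
  · split_ifs with h1 h2
    · have h := (HasLaurentValue.X (w⁻¹ • x)).mul (hasLaurentValue_coeff_Tword hl w⁻¹)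
      rw [twoRhoVec_smul_of_isMinuscule hx hm, inv_inv] at h
      rw [hmul, h1]
      exact h
    · rw [hmul]
      exact (HasLaurentValue.X (w⁻¹ • x)).mul (hf₀ w⁻¹ v)
    · have h3 : (Tword b l).coeff v = 0 := by
        by_contra hne
        exact h2 ⟨h1, l, hl, exists_sublist_of_coeff_Tword_ne_zero hne⟩
      rw [fn_mul_coeff, h3, mul_zero, map_zero]
      exact HasLaurentValue.zero
  · simp only [spinMul_mul_delta]
    rw [spinOp_add_coeff_apply, sum_spinOp_coeff_apply]
    simp only [single_coeff_apply, sum_zeta_apply, Finset.mem_univ, if_true]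
    rw [Finset.sum_ite_eq]
    simp only [Finset.mem_filter, Finset.mem_univ, true_and]
    by_cases h1 : v = (uElt b x)⁻¹
    · rw [if_pos h1, if_pos h1, if_neg fun h => h.1 h1, add_zero, map_mul, map_prod,
        Finset.prod_filter]
      congr 1
      refine Finset.prod_congr rfl fun α _ => ?_
      rw [moveValue]
      split_ifs
      · rw [map_sub, map_one, ← X_neg]; rfl
      · rw [map_one]
    · rw [if_neg h1, if_neg h1, zero_add]
      split_ifs
      · rfl
      · rw [map_zero]

/-! ### The limit of the affine generator T_0. -/

lemma evalAt_inv_X (b : P.Base) (u : P.weylGroup) (i : ι) :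
    evalAt b u (X _ (rootWt P i))⁻¹ =
      tMonomial P (twoRhoVec b (rootWt P (u • i))) * X _ (-rootWt P (u • i)) := by
  rw [← X_neg, evalAt_X, smul_neg, twoRhoVec_neg, neg_neg, smul_rootWt]

lemma Tinv_prod_cons (b : P.Base) (j : b.support) (l : List b.support) (L : ReflOp P) :
    ((j :: l).map (Tinv b)).prod * L = Tinv b j * ((l.map (Tinv b)).prod * L) := by
  rw [List.map_cons, List.prod_cons, mul_assoc]

/-- Induction on the suffix of a reduced word of s_ϑ. The first bound starts from the exact order of
X_ϑ⁻¹ and persists while the root v⁻¹(α_j) of the new letter differs from ϑ; the letter with root ϑ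
switches to the second bound, which then persists. For the whole word both imply order at least that
of t_0^{-1/2}. -/
lemma IsMaximalShortRoot.opOrder_prod_Tinv {b : P.Base} {θ : ι} (hθ : IsMaximalShortRoot b θ)
    {l₁ l₂ : List b.support} (hl : IsReducedWord b (l₁ ++ l₂) (weylGroup.ofIdx P θ)) :
    OpOrder b (fun u => invVec b (u * wordProd b l₂) - invVec b u +
        twoRhoVec b (rootWt P ((u * wordProd b l₂) • θ)))
      ((l₂.map (Tinv b)).prod * fn (X _ (rootWt P θ))⁻¹) ∨
    OpOrder b (fun u => invVec b (u * (wordProd b l₁)⁻¹) - invVec b u - lenVec P θ)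
      ((l₂.map (Tinv b)).prod * fn (X _ (rootWt P θ))⁻¹) := by
  induction l₂ generalizing l₁ with
  | nil =>
    left
    intro u v
    simp only [List.map_nil, List.prod_nil, one_mul, wordProd_nil, mul_one, sub_self, zero_add,
      fn_coeff]
    split_ifs
    · rw [evalAt_inv_X]
      exact HasOrder.tMonomial_mul_X _ _
    · rw [map_zero]
      exact HasOrder.zero _
  | cons j l₂ ih =>
    rw [Tinv_prod_cons]
    have hpos : b.IsPos ((wordProd b l₂)⁻¹ • (j : ι)) := hl.isPos_suffix
    have hpos' : b.IsPos (wordProd b l₁ • (j : ι)) := hl.isPos_prefix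
    have hprod : wordProd b l₁ * (simpleRefl b j * wordProd b l₂) = weylGroup.ofIdx P θ := by
      rw [← wordProd_cons, ← wordProd_append, hl.1]
    have hih := ih (l₁ := l₁ ++ [j]) (by rwa [List.append_assoc])
    rw [wordProd_append, wordProd_cons, wordProd_nil, mul_one] at hih
    simp only [mul_inv_rev, ofIdx_inv] at hih
    rw [wordProd_cons]
    set v := wordProd b l₂ with hv
    set x := wordProd b l₁ with hx
    rcases hih with hA | hH
    -- The letter with root ϑ is the middle of the word: s_j v = v s_ϑ, so the prefix before it
    -- represents v⁻¹.
    · by_cases hβ : v⁻¹ • (j : ι) = θ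
      · right
        have hj : v • θ = (j : ι) := by rw [← hβ, smul_inv_smul]
        have hsv : simpleRefl b j * v = v * weylGroup.ofIdx P θ := by rw [mul_ofIdx, hj]
        have hxv : x⁻¹ = v := by
          rw [hsv, ← mul_assoc, mul_eq_right] at hprod
          exact inv_eq_of_mul_eq_one_right hprod
        have hlen : lenVec P (j : ι) = lenVec P θ := by rw [← hj, lenVec_smul]
        rw [hxv]
        refine hA.Tinv_mul j (fun u => ?_) (fun u hu => ?_) (fun u hu => ?_)
        · intro ν
          have h1 := congrFun (hθ.invVec_mul (u * v)) ν
          have h2 : (u * simpleRefl b j * v) • θ = negIdx P (u • (j : ι)) := by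
            rw [mul_smul, mul_smul, hj, ofIdx_smul_self, smul_negIdx]
          rw [invVec_mul_simple b u j, h2, mul_assoc u, hsv, ← mul_assoc, rootWt_negIdx,
            twoRhoVec_neg, hlen]
          rw [mul_smul, hj] at h1
          have h3 := lenVec_nonneg P θ ν
          simp only [Pi.add_apply, Pi.sub_apply, Pi.neg_apply, Pi.smul_apply, smul_eq_mul] at h1 ⊢
          rcases rootSign_eq_or b (u • (j : ι)) with h4 | h4 <;> rw [h4] at h1 ⊢ <;> linarith
        · intro ν
          have h1 := twoRhoVec_root_nonneg hu ν
          rw [mul_smul, hj, hlen]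
          simp only [Pi.add_apply, Pi.sub_apply, Pi.neg_apply, Pi.zero_apply] at h1 ⊢
          linarith
        · rw [mul_smul, hj, hlen]
          exact le_of_eq (by abel)
      · left
        have hsθ : weylGroup.ofIdx P θ • (v⁻¹ • (j : ι)) = negIdx P (x • (j : ι)) := by
          rw [← hprod, mul_smul, mul_smul, smul_inv_smul, ofIdx_smul_self, smul_negIdx]
        -- The root v⁻¹(α_j) is made negative by s_ϑ and differs from ϑ, so the pairing is positive
        -- and at most 1. Hence prepending s_j changes the image of ϑ under uv by exactly u(α_j).
        have hw : wpair P (rootWt P θ) (v⁻¹ • (j : ι)) = 1 := by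
          have h1 := hθ.wpair_le_one hpos hβ
          have h2 := wpair_pos_of_inversion hθ.isPos hpos (by
            rw [hsθ, isPos_negIdx]; exact not_not.mpr hpos')
          omega
        have hmove : ∀ u, twoRhoVec b (rootWt P ((u * (simpleRefl b j * v)) • θ)) =
            twoRhoVec b (rootWt P ((u * v) • θ)) - twoRhoVec b (rootWt P (u • (j : ι))) := by
          intro u
          have h1 : u * (simpleRefl b j * v) = u * v * weylGroup.ofIdx P (v⁻¹ • (j : ι)) := by
            rw [mul_assoc u, mul_ofIdx, smul_inv_smul]
          rw [h1, ← smul_rootWt, mul_smul, ofIdx_smul_weight, hw, one_smul, smul_sub,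
            twoRhoVec_sub, smul_rootWt, smul_rootWt, mul_smul u v (v⁻¹ • (j : ι)), smul_inv_smul]
        refine hA.Tinv_mul j (fun u => ?_) (fun u hu => ?_) (fun u hu => ?_)
        · rw [invVec_mul_simple b u j, mul_assoc u]
          exact le_of_eq (by abel)
        · intro ν
          have h1 := invVec_move_le_of_pos b (v := v) ν hu
          rw [hmove]
          simp only [Pi.add_apply, Pi.sub_apply, Pi.neg_apply] at h1 ⊢
          linarith
        · intro ν
          have h1 := invVec_move_le_of_not_pos b ν hu hpos
          rw [hmove]
          simp only [Pi.add_apply, Pi.sub_apply, Pi.neg_apply] at h1 ⊢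
          linarith
    · right
      refine hH.Tinv_mul j (fun u => ?_) (fun u hu => ?_) (fun u hu => ?_)
      · rw [invVec_mul_simple b u j, mul_assoc u, ofIdx_mul_ofIdx_mul]
        exact le_of_eq (by abel)
      · intro ν
        have h1 := le_invVec_move_of_pos b ν hu (v := x⁻¹) (by rwa [inv_inv])
        simp only [Pi.add_apply, Pi.sub_apply, Pi.neg_apply] at h1 ⊢
        linarith
      · intro ν
        have h1 := le_invVec_move_of_not_pos b (v := x⁻¹) ν hu
        simp only [Pi.add_apply, Pi.sub_apply, Pi.neg_apply] at h1 ⊢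
        linarith

/-- The limit of `t_0^{1/2} T_{s_ϑ}⁻¹ X_ϑ⁻¹` exists. -/
theorem exists_hasRE_T_zero {b : P.Base} {θ : ι} (hθ : IsMaximalShortRoot b θ)
    {l : List b.support} (hl : IsReducedWord b l (weylGroup.ofIdx P θ)) :
    ∃ L₀, HasRE b (fn (tHalfFn P (nuOf P θ)) * Ring.inverse (Tword b l) *
      fn (X _ (rootWt P θ))⁻¹) L₀ := by
  -- The inverse of T_w multiplies the T_j⁻¹ in the reversed order; as s_ϑ is an involution, the
  -- reversed word is again a reduced word of s_ϑ.
  have hrev := hl.reverse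
  rw [ofIdx_inv] at hrev
  have horder : OpOrder b (fun _ => -lenVec P θ)
      (((l.reverse.map (Tinv b)).prod) * fn (X _ (rootWt P θ))⁻¹) := by
    rcases hθ.opOrder_prod_Tinv (l₁ := []) (l₂ := l.reverse) hrev with h | h
    · simp only [hrev.1, mul_smul, ofIdx_smul_self, smul_negIdx, rootWt_negIdx, twoRhoVec_neg] at h
      refine fun u v => (h u v).mono fun ν => ?_
      -- Since s_ϑ(ϑ) = -ϑ, the pairings with ρ^∨ cancel and only the unit vector of ϑ remains, up
      -- to sign.
      have h1 := congrFun (hθ.invVec_mul u) ν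
      have h2 := lenVec_nonneg P θ ν
      simp only [Pi.add_apply, Pi.sub_apply, Pi.neg_apply, Pi.smul_apply, smul_eq_mul] at h1 ⊢
      rcases rootSign_eq_or b (u • θ) with h4 | h4 <;> rw [h4] at h1 <;> linarith
    · simp only [wordProd_nil, inv_one, mul_one, sub_self, zero_sub] at h
      exact h
  refine OpOrder.exists_hasRE fun u v => ?_
  rw [inverse_Tword, mul_assoc, fn_mul_coeff, (evalAt b u).map_mul, tHalfFn_eq, evalAt_tMonomial]
  obtain ⟨f, hf⟩ := horder u v
  refine ⟨f, ?_⟩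
  rw [Pi.zero_apply, neg_zero, tMonomial_zero, one_mul]
  rwa [neg_neg] at hf

end Limits
end
end SpinorRE

theorem proposition5p5 {ι M N : Type*} [Fintype ι]
    [AddCommGroup M] [Module ℝ M] [AddCommGroup N] [Module ℝ N]
    (P : RootPairing ι ℝ M N) [P.IsRootSystem] [P.IsCrystallographic] [P.IsReduced]
    [P.IsIrreducible] (b : P.Base) :
    -- the operators `t_i^{1/2} T_i`, for `i > 0`
    (∀ i : b.support,
      SpinorRE.HasRE b
        (SpinorRE.fn (SpinorRE.tHalfFn P (SpinorRE.nuOf P i)) * SpinorRE.T b i)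
        (∑ w : P.weylGroup with ¬ b.IsPos (w⁻¹ • (i : ι)),
          SpinorRE.spinMul (SpinorRE.zeta w 1) *
            (SpinorRE.delta _ (SpinorRE.simpleRefl b i) - 1))) ∧
    -- the operator `t_0^{1/2} T_{s_ϑ}⁻¹ X_ϑ⁻¹`
    (∀ θ : ι, SpinorRE.IsMaximalShortRoot b θ →
      ∀ l : List b.support,
        SpinorRE.IsReducedWord b l (RootPairing.weylGroup.ofIdx P θ) →
      ∃ L₀, SpinorRE.HasRE b
        (SpinorRE.fn (SpinorRE.tHalfFn P (SpinorRE.nuOf P θ)) *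
          Ring.inverse (SpinorRE.Tword b l) *
          SpinorRE.fn (SpinorRE.X _ (SpinorRE.rootWt P θ))⁻¹) L₀) ∧
    -- the operators `q^{(b_+, ρ_k)} X_b`
    (∀ x xp : SpinorRE.weightLattice P,
      xp ∈ MulAction.orbit P.weylGroup x → SpinorRE.IsDominant b xp →
      SpinorRE.HasRE b
        (SpinorRE.fn (SpinorRE.qRhoFn b xp * SpinorRE.X _ x))
        (SpinorRE.spinMul (∑ w : P.weylGroup with w⁻¹ • x = xp,
          SpinorRE.zeta w (SpinorRE.X SpinorRE.FieldQ xp)))) ∧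
    -- the operators `X_{ω_r} T_{u_r⁻¹}`
    (∀ (r : b.support) (ω : SpinorRE.weightLattice P),
      SpinorRE.IsFundamentalWeight b r ω → SpinorRE.IsMinuscule b ω →
      ∀ l : List b.support, SpinorRE.IsReducedWord b l (SpinorRE.uElt b ω)⁻¹ →
      ∃ f : P.weylGroup → P.weylGroup → SpinorRE.Laurent SpinorRE.FieldQ P,
        SpinorRE.HasRE b
          (SpinorRE.fn (SpinorRE.X _ ω) * SpinorRE.Tword b l)
          (SpinorRE.spinMul (∑ w : P.weylGroup, SpinorRE.zeta w
              (SpinorRE.X SpinorRE.FieldQ (w⁻¹ • ω) *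
                ∏ α ∈ SpinorRE.lambdaSet b (SpinorRE.uElt b ω) with
                  P.toLinearMap (P.root (w⁻¹ • α)) (SpinorRE.rhoVee b) = 1,
                  (1 - (SpinorRE.X SpinorRE.FieldQ (SpinorRE.rootWt P (w⁻¹ • α)))⁻¹))) *
              SpinorRE.delta _ (SpinorRE.uElt b ω)⁻¹ +
            ∑ v : P.weylGroup with SpinorRE.BruhatLT b v (SpinorRE.uElt b ω)⁻¹,
              SpinorRE.spinMul (∑ w : P.weylGroup,
                SpinorRE.zeta w (algebraMap _ _ (f v w))) * SpinorRE.delta _ v)) := by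
  exact ⟨fun i => SpinorRE.hasRE_T b i,
    fun θ hθ l hl => SpinorRE.exists_hasRE_T_zero hθ hl,
    fun x xp hx hxp => SpinorRE.hasRE_X hx hxp,
    fun r ω hω hm l hl => SpinorRE.hasRE_X_mul_Tword hω.isDominant hm hl⟩
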